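/- \textbf{Setting.} An \emph{enhanced 2-category} is a (strict) 2-category $\mathcal K$ with a wide, locally full sub-2-category of \emph{tight} 1-cells; arbitrary 1-cells are called loose. A \emph{discrete opfibration} is a 1-cell $p:E\to B$ such that for all $e:X\to E$, $b:X\to B$ and $\varphi:pe\Rightarrow b$ there is a unique pair $(e',\lambda:e\Rightarrow e')$ with $pe'=b$ and $p\lambda=\varphi$. A \emph{left-tight pullback} of a tight $p:E\to B$ along a loose $f:A\to B$ is a strict 2-pullback $P$ whose projection $P\to A$ is tight and detects tightness (if $X\to P\to A$ is tight then so is $X\to P$). $\mathcal K$ is a \emph{plumbus} if it has a tight terminal object $1$ (a terminal object all maps into which are tight) and all left-tight pullbacks of tight discrete opfibrations along loose maps. Fix in the plumbus $\mathcal K$ a class of tight discrete opfibrations, called \emph{small}, stable under left-tight pullback along loose maps and containing $\mathrm{id}_1$. For a small $u:\Omega_\bullet\to\Omega$, a map $f:B\to\Omega$ \emph{classifies} $p:E\to B$ if there is a left-tight pullback square exhibiting $p$ as the pullback of $u$ along $f$. Suppose that $u$ is a \emph{2-classifier}: for every $B$ the functor $f\mapsto f^*u$ from $\mathcal K(B,\Omega)$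 to tight discrete opfibrations over $B$ is fully faithful, and every small discrete opfibration is classified by some $f$. Let $(T,i,m)$ be a 2-monad on $\mathcal K$ such that $T$ preserves tightness and $i,m$ have tight components. Let $\mathrm{Alg}_{\mathrm{lx}}(T)$ be the enhanced 2-category of strict $T$-algebras with tight structure map, lax $T$-morphisms and $T$-2-morphisms, whose tight 1-cells are the strict $T$-morphisms that are tight in $\mathcal K$. A tight discrete opfibration of $\mathrm{Alg}_{\mathrm{lx}}(T)$ is called small if its underlying 1-cell is small in $\mathcal K$. Suppose that \begin{enumerate} \item[(A)] $Tu$ is small; \item[(B)] $T$ sends each left-tight pullback of $u$ to a strict 2-pullback; \item[(C)] the naturality squares of $i$ and $m$ at $u$ are strict 2-pullbacks; \item[(D)] $Tu$ has a tight classifying map $\omega:T\Omega\to\Omega$, say with classifying pullback square having top side $\omega_\bullet:T\Omega_\bullet\to\Omega_\bullet$; \item[(E)] $(\Omega,\omega)$ is a strict $T$-algebra. \end{enumerate} \textbf{Statement.} Then $\omega_\bullet$ is a tight strict $T$-algebra structure on $\Omega_\bullet$ (so that $u$ is a strict $T$-morphism $(\Omega_\bullet,\omega_\bullet)\to(\Omega,\omega)$),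 and for every small discrete opfibration $p:(E,\eta)\to(B,\beta)$ in $\mathrm{Alg}_{\mathrm{lx}}(T)$: \begin{enumerate} \item there is a lax $T$-morphism $\mathrm dp:(B,\beta)\to(\Omega,\omega)$ that classifies $p$ with respect to $u$ in $\mathrm{Alg}_{\mathrm{lx}}(T)$; \item every such lax classifying map $\mathrm dp$ is a pseudo $T$-morphism (its laxator is invertible) if and only if $p$ is $T$-cartesian, i.e. the $T$-cartesianity defect $\delta_p:TE\to\beta^*E$ -- the comparison map with components $\eta:TE\to E$ and $Tp:TE\to TB$ into the pullback in $\mathcal K$ of $p$ along $\beta:TB\to B$ -- is a split equivalence in $\mathcal K$ (there is $s$ with $\delta_p s=\mathrm{id}$ and $s\delta_p\cong\mathrm{id}$). \end{enumerate} -/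

import Mathlib

open CategoryTheory Bicategory

universe w v u

/-! ## Equality of 2-cells in a strict 2-category

A 2-category is a bicategory `K` with `Bicategory.Strict K`. Since composition of 1-cells is only
propositionally associative and unital, 2-cells are compared together with their boundaries. -/

section CellEq

variable {K : Type u} [Bicategory.{w, v} K]

/-- Two 2-cells are equal, after identifying their (equal) sources and (equal) targets. -/
def CellEq {a b : K} {f g f' g' : a ⟶ b} (φ : f ⟶ g) (ψ : f' ⟶ g') : Prop :=
  f = f' ∧ g = g' ∧ HEq φ ψ

infix:50 " ≗ " => CellEq

theorem cellEq_iff {a b : K} {f g f' g' : a ⟶ b} {φ : f ⟶ g} {ψ : f' ⟶ g'} :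
    φ ≗ ψ ↔ ∃ (h : f = f') (k : g = g'), φ ≫ eqToHom k = eqToHom h ≫ ψ := by
  constructor
  · rintro ⟨rfl, rfl, h⟩
    exact ⟨rfl, rfl, by simpa using eq_of_heq h⟩
  · rintro ⟨rfl, rfl, h⟩
    exact ⟨rfl, rfl, by simpa using h⟩

namespace CellEq

variable {a b c d : K}

theorem refl {f g : a ⟶ b} (φ : f ⟶ g) : φ ≗ φ := ⟨rfl, rfl, HEq.rfl⟩

theorem of_eq {f g : a ⟶ b} {φ ψ : f ⟶ g} (h : φ = ψ) : φ ≗ ψ := h ▸ refl φ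

theorem eq {f g : a ⟶ b} {φ ψ : f ⟶ g} (h : φ ≗ ψ) : φ = ψ := eq_of_heq h.2.2

theorem symm {f g f' g' : a ⟶ b} {φ : f ⟶ g} {ψ : f' ⟶ g'} (h : φ ≗ ψ) : ψ ≗ φ :=
  ⟨h.1.symm, h.2.1.symm, h.2.2.symm⟩

theorem trans {f g f' g' f'' g'' : a ⟶ b} {φ : f ⟶ g} {ψ : f' ⟶ g'} {χ : f'' ⟶ g''}
    (h : φ ≗ ψ) (k : ψ ≗ χ) : φ ≗ χ :=
  ⟨h.1.trans k.1, h.2.1.trans k.2.1, h.2.2.trans k.2.2⟩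

theorem comp {f g h f' g' h' : a ⟶ b} {φ : f ⟶ g} {ψ : g ⟶ h} {φ' : f' ⟶ g'} {ψ' : g' ⟶ h'}
    (e₁ : φ ≗ φ') (e₂ : ψ ≗ ψ') : φ ≫ ψ ≗ φ' ≫ ψ' := by
  obtain ⟨rfl, rfl, e₁⟩ := e₁
  obtain ⟨-, rfl, e₂⟩ := e₂
  obtain rfl := eq_of_heq e₁
  obtain rfl := eq_of_heq e₂
  exact refl _

theorem eqToHom_comp {f g h : a ⟶ b} (e : f = g) (φ : g ⟶ h) : eqToHom e ≫ φ ≗ φ := by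
  subst e
  exact of_eq (by simp)

theorem comp_eqToHom {f g h : a ⟶ b} (φ : f ⟶ g) (e : g = h) : φ ≫ eqToHom e ≗ φ := by
  subst e
  exact of_eq (by simp)

theorem eqToHom_left {f g : a ⟶ b} (e : f = g) : eqToHom e ≗ 𝟙 f := by
  subst e
  exact refl _

theorem id_congr {f g : a ⟶ b} (e : f = g) : 𝟙 f ≗ 𝟙 g := by
  subst e
  exact refl _

theorem whiskerLeft {f f' : a ⟶ b} {g h g' h' : b ⟶ c} {φ : g ⟶ h} {ψ : g' ⟶ h'}
    (e : f = f') (k : φ ≗ ψ) : f ◁ φ ≗ f' ◁ ψ := by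
  obtain ⟨rfl, rfl, k⟩ := k
  obtain rfl := eq_of_heq k
  subst e
  exact refl _

theorem whiskerRight {f g f' g' : a ⟶ b} {h h' : b ⟶ c} {φ : f ⟶ g} {ψ : f' ⟶ g'}
    (k : φ ≗ ψ) (e : h = h') : φ ▷ h ≗ ψ ▷ h' := by
  obtain ⟨rfl, rfl, k⟩ := k
  obtain rfl := eq_of_heq k
  subst e
  exact refl _

theorem conj {f f' g g' : a ⟶ b} (e : f = f') (φ : f' ⟶ g') (e' : g' = g) :
    eqToHom e ≫ φ ≫ eqToHom e' ≗ φ :=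
  (eqToHom_comp _ _).trans (comp_eqToHom _ _)

/-- Congruence for vertical composites through equal, but not syntactically equal, 1-cells. -/
theorem paste {f g g₁ h f' g' g₁' h' : a ⟶ b} {φ : f ⟶ g} {ψ : g₁ ⟶ h} {φ' : f' ⟶ g'}
    {ψ' : g₁' ⟶ h'} (e : g = g₁) (e' : g' = g₁') (k₁ : φ ≗ φ') (k₂ : ψ ≗ ψ') :
    φ ≫ eqToHom e ≫ ψ ≗ φ' ≫ eqToHom e' ≫ ψ' :=
  k₁.comp ((eqToHom_comp _ _).trans (k₂.trans (eqToHom_comp _ _).symm))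

theorem eqToIso_hom_id {f g : a ⟶ b} {φ : f ≅ g} {e : f = g} (h : φ = eqToIso e) :
    φ.hom ≗ 𝟙 f := by
  subst e h
  exact refl _

theorem eqToIso_inv_id {f g : a ⟶ b} {φ : f ≅ g} {e : f = g} (h : φ = eqToIso e) :
    φ.inv ≗ 𝟙 g := by
  subst e h
  exact refl _

variable [Bicategory.Strict K]

theorem comp_whiskerLeft (f : a ⟶ b) (g : b ⟶ c) {h h' : c ⟶ d} (φ : h ⟶ h') :
    (f ≫ g) ◁ φ ≗ f ◁ g ◁ φ := by
  rw [Bicategory.comp_whiskerLeft, Strict.associator_eqToIso, Strict.associator_eqToIso]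
  simp only [eqToIso.hom, eqToIso.inv]
  exact conj _ _ _

theorem whiskerRight_comp {f f' : a ⟶ b} (φ : f ⟶ f') (g : b ⟶ c) (h : c ⟶ d) :
    φ ▷ (g ≫ h) ≗ φ ▷ g ▷ h := by
  rw [Bicategory.whiskerRight_comp, Strict.associator_eqToIso, Strict.associator_eqToIso]
  simp only [eqToIso.hom, eqToIso.inv]
  exact conj _ _ _

theorem whisker_assoc (f : a ⟶ b) {g g' : b ⟶ c} (φ : g ⟶ g') (h : c ⟶ d) :
    (f ◁ φ) ▷ h ≗ f ◁ φ ▷ h := by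
  rw [Bicategory.whisker_assoc, Strict.associator_eqToIso, Strict.associator_eqToIso]
  simp only [eqToIso.hom, eqToIso.inv]
  exact conj _ _ _

theorem id_whiskerLeft {f f' : a ⟶ b} (φ : f ⟶ f') : 𝟙 a ◁ φ ≗ φ := by
  rw [Bicategory.id_whiskerLeft, Strict.leftUnitor_eqToIso, Strict.leftUnitor_eqToIso]
  simp only [eqToIso.hom, eqToIso.inv]
  exact conj _ _ _

theorem whiskerRight_id {f f' : a ⟶ b} (φ : f ⟶ f') : φ ▷ 𝟙 b ≗ φ := by
  rw [Bicategory.whiskerRight_id, Strict.rightUnitor_eqToIso, Strict.rightUnitor_eqToIso]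
  simp only [eqToIso.hom, eqToIso.inv]
  exact conj _ _ _

end CellEq

end CellEq

/-! ## Enhanced 2-categories, discrete opfibrations, pullbacks -/

/-- An enhancement of a 2-category: a wide, locally full sub-2-category of *tight* 1-cells.
Arbitrary 1-cells are called *loose*. -/
class Enhancement (K : Type u) [Bicategory.{w, v} K] where
  IsTight : ∀ {a b : K}, (a ⟶ b) → Prop
  id_tight : ∀ a : K, IsTight (𝟙 a)
  comp_tight : ∀ {a b c : K} (f : a ⟶ b) (g : b ⟶ c), IsTight f → IsTight g → IsTight (f ≫ g)

section Basic

variable {K : Type u} [Bicategory.{w, v} K]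

/-- `p : E ⟶ B` is a discrete opfibration: every 2-cell `φ : e ≫ p ⟶ b` has a unique lift
`e ⟶ e'` along `p`. -/
def IsDiscOpfib {E B : K} (p : E ⟶ B) : Prop :=
  ∀ ⦃X : K⦄ (e : X ⟶ E) (b : X ⟶ B) (φ : e ≫ p ⟶ b),
    ∃! l : (Σ e' : X ⟶ E, (e ⟶ e')), l.2 ▷ p ≗ φ

/-- The codomain `φ_* e` of the unique lift of `φ : e ≫ p ⟶ b` starting at `e`. -/
noncomputable def IsDiscOpfib.push {E B : K} {p : E ⟶ B} (hp : IsDiscOpfib p)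
    {X : K} (e : X ⟶ E) {b : X ⟶ B} (φ : e ≫ p ⟶ b) : X ⟶ E :=
  (hp e b φ).choose.1

theorem IsDiscOpfib.push_comp {E B : K} {p : E ⟶ B} (hp : IsDiscOpfib p)
    {X : K} (e : X ⟶ E) {b : X ⟶ B} (φ : e ≫ p ⟶ b) : hp.push e φ ≫ p = b :=
  (hp e b φ).choose_spec.1.2.1

/-- The square below is a (strict, 2-dimensional) pullback.
```
  P --top--> E
  |left      | p
  A ---f---> B
```
-/
structure IsTwoPullback {P E A B : K} (top : P ⟶ E) (left : P ⟶ A) (p : E ⟶ B) (f : A ⟶ B) :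
    Prop where
  w : top ≫ p = left ≫ f
  existsUnique_lift : ∀ ⦃X : K⦄ (e : X ⟶ E) (a : X ⟶ A), e ≫ p = a ≫ f →
    ∃! h : X ⟶ P, h ≫ top = e ∧ h ≫ left = a
  existsUnique_lift₂ : ∀ ⦃X : K⦄ (h k : X ⟶ P) (σ : h ≫ top ⟶ k ≫ top)
    (τ : h ≫ left ⟶ k ≫ left), σ ▷ p ≗ τ ▷ f →
    ∃! θ : h ⟶ k, θ ▷ top = σ ∧ θ ▷ left = τ

namespace IsTwoPullback

variable {P E A B : K} {top : P ⟶ E} {left : P ⟶ A} {p : E ⟶ B} {f : A ⟶ B}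

/-- The comparison 1-cell into a pullback. -/
noncomputable def lift (sq : IsTwoPullback top left p f) {X : K} (e : X ⟶ E) (a : X ⟶ A)
    (h : e ≫ p = a ≫ f) : X ⟶ P :=
  (sq.existsUnique_lift e a h).choose

theorem lift_top (sq : IsTwoPullback top left p f) {X : K} (e : X ⟶ E) (a : X ⟶ A)
    (h : e ≫ p = a ≫ f) : sq.lift e a h ≫ top = e :=
  (sq.existsUnique_lift e a h).choose_spec.1.1

theorem lift_left (sq : IsTwoPullback top left p f) {X : K} (e : X ⟶ E) (a : X ⟶ A)
    (h : e ≫ p = a ≫ f) : sq.lift e a h ≫ left = a :=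
  (sq.existsUnique_lift e a h).choose_spec.1.2

/-- The action of pullback of a discrete opfibration `p` on a 2-cell `φ : f ⟶ f'`: the map
`f^* p ⟶ f'^* p` over `A` whose component in `E` is the codomain of the lift of `left ◁ φ`
starting at `top`. -/
noncomputable def reindex (hp : IsDiscOpfib p) (sq : IsTwoPullback top left p f)
    {P' : K} {top' : P' ⟶ E} {left' : P' ⟶ A} {f' : A ⟶ B}
    (sq' : IsTwoPullback top' left' p f') (φ : f ⟶ f') : {h : P ⟶ P' // h ≫ left' = left} :=
  ⟨sq'.lift (hp.push top (eqToHom sq.w ≫ left ◁ φ)) left (hp.push_comp _ _),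
    sq'.lift_left _ _ _⟩

end IsTwoPullback

/-- A split equivalence: `f` has a strict section `s` such that `s` after `f` is isomorphic to the
identity. -/
def IsSplitEquivalence {X Y : K} (f : X ⟶ Y) : Prop :=
  ∃ s : Y ⟶ X, s ≫ f = 𝟙 Y ∧ Nonempty (f ≫ s ≅ 𝟙 X)

variable [Enhancement K]

open Enhancement

/-- A tight discrete opfibration. -/
structure IsTightDiscOpfib {E B : K} (p : E ⟶ B) : Prop where
  tight : IsTight p
  discOpfib : IsDiscOpfib p

/-- A left-tight pullback (of a tight `p` along a loose `f`): a pullback square whose left leg is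
tight and detects tightness. -/
structure IsLeftTightPullback {P E A B : K} (top : P ⟶ E) (left : P ⟶ A) (p : E ⟶ B)
    (f : A ⟶ B) : Prop extends IsTwoPullback top left p f where
  left_tight : IsTight left
  detects_tight : ∀ ⦃X : K⦄ (h : X ⟶ P), IsTight (h ≫ left) → IsTight h

/-- A tight terminal object: a (2-dimensional) terminal object such that all maps into it are
tight. -/
structure IsTightTerminal (one : K) : Prop where
  unique_hom : ∀ X : K, Nonempty (Unique (X ⟶ one))
  unique_cell : ∀ {X : K} (f g : X ⟶ one), Nonempty (Unique (f ⟶ g))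
  tight : ∀ {X : K} (f : X ⟶ one), IsTight f

variable (K) in
/-- A plumbus: an enhanced 2-category with a tight terminal object and all left-tight pullbacks of
tight discrete opfibrations. -/
structure IsPlumbus : Prop where
  exists_terminal : ∃ one : K, IsTightTerminal one
  exists_pullback : ∀ {E A B : K} (p : E ⟶ B) (f : A ⟶ B), IsTightDiscOpfib p →
    ∃ (P : K) (top : P ⟶ E) (left : P ⟶ A), IsLeftTightPullback top left p f

variable (K) in
/-- A pullback-ideal of tight discrete opfibrations, called *small*, containing the identity of the
tight terminal object. -/
structure SmallClass where
  Small : ∀ {E B : K}, (E ⟶ B) → Prop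
  tightDiscOpfib : ∀ {E B : K} {p : E ⟶ B}, Small p → IsTightDiscOpfib p
  pullback_stable : ∀ {P E A B : K} {top : P ⟶ E} {left : P ⟶ A} {p : E ⟶ B} {f : A ⟶ B},
    Small p → IsLeftTightPullback top left p f → Small left
  id_terminal : ∀ {one : K}, IsTightTerminal one → Small (𝟙 one)

/-- `f : B ⟶ Ω` is a classifying map of `p : E ⟶ B` with respect to `u : Ω' ⟶ Ω`: the map `p` is
(a left-tight) pullback of `u` along `f`. -/
def Classifies {Ω' Ω E B : K} (u : Ω' ⟶ Ω) (p : E ⟶ B) (f : B ⟶ Ω) : Prop :=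
  ∃ top : E ⟶ Ω', IsLeftTightPullback top p u f

/-- A 2-classifier for small discrete opfibrations: a small discrete opfibration `u : Ω' ⟶ Ω` such
that pulling back `u` is fully faithful from `K(B, Ω)` to tight discrete opfibrations over `B`, with
essential image the small ones. -/
structure IsTwoClassifier (S : SmallClass K) {Ω' Ω : K} (u : Ω' ⟶ Ω) : Prop where
  small : S.Small u
  fullyFaithful : ∀ {B P P' : K} {f f' : B ⟶ Ω} {top : P ⟶ Ω'} {left : P ⟶ B}
    {top' : P' ⟶ Ω'} {left' : P' ⟶ B} (sq : IsLeftTightPullback top left u f)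
    (sq' : IsLeftTightPullback top' left' u f'),
    Function.Bijective (IsTwoPullback.reindex (S.tightDiscOpfib small).discOpfib
      sq.toIsTwoPullback sq'.toIsTwoPullback)
  exists_classifies : ∀ {E B : K} (p : E ⟶ B), S.Small p → ∃ f : B ⟶ Ω, Classifies u p f

end Basic

/-! ## Enhanced 2-monads -/

open Enhancement

/-- An enhanced 2-monad: a 2-functor `T` preserving tight maps with 2-natural unit and
multiplication whose components are tight, satisfying the monad laws strictly. -/
structure EnhancedMonad (K : Type u) [Bicategory.{w, v} K] [Bicategory.Strict K]
    [Enhancement K] where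
  T : StrictPseudofunctor K K
  map_tight : ∀ {a b : K} (f : a ⟶ b), IsTight f → IsTight (T.map f)
  unit : ∀ a : K, a ⟶ T.obj a
  unit_tight : ∀ a : K, IsTight (unit a)
  unit_natural : ∀ {a b : K} (f : a ⟶ b), f ≫ unit b = unit a ≫ T.map f
  unit_natural₂ : ∀ {a b : K} {f g : a ⟶ b} (φ : f ⟶ g), φ ▷ unit b ≗ unit a ◁ T.map₂ φ
  mult : ∀ a : K, T.obj (T.obj a) ⟶ T.obj a
  mult_tight : ∀ a : K, IsTight (mult a)
  mult_natural : ∀ {a b : K} (f : a ⟶ b), T.map (T.map f) ≫ mult b = mult a ≫ T.map f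
  mult_natural₂ : ∀ {a b : K} {f g : a ⟶ b} (φ : f ⟶ g),
    T.map₂ (T.map₂ φ) ▷ mult b ≗ mult a ◁ T.map₂ φ
  unit_mult : ∀ a : K, unit (T.obj a) ≫ mult a = 𝟙 (T.obj a)
  map_unit_mult : ∀ a : K, T.map (unit a) ≫ mult a = 𝟙 (T.obj a)
  mult_mult : ∀ a : K, T.map (mult a) ≫ mult a = mult (T.obj a) ≫ mult a

namespace EnhancedMonad

variable {K : Type u} [Bicategory.{w, v} K] [Bicategory.Strict K] [Enhancement K]
  (M : EnhancedMonad K)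

theorem map₂_congr {a b : K} {f g f' g' : a ⟶ b} {φ : f ⟶ g} {ψ : f' ⟶ g'} (h : φ ≗ ψ) :
    M.T.map₂ φ ≗ M.T.map₂ ψ := by
  obtain ⟨rfl, rfl, h⟩ := h
  obtain rfl := eq_of_heq h
  exact CellEq.refl _

theorem map₂_whiskerLeft {a b c : K} (f : a ⟶ b) {g g' : b ⟶ c} (φ : g ⟶ g') :
    M.T.map₂ (f ◁ φ) ≗ M.T.map f ◁ M.T.map₂ φ := by
  rw [M.T.map₂_whisker_left, M.T.mapComp_eq_eqToIso, M.T.mapComp_eq_eqToIso]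
  simp only [eqToIso.hom, eqToIso.inv]
  exact CellEq.conj _ _ _

theorem map₂_whiskerRight {a b c : K} {f f' : a ⟶ b} (φ : f ⟶ f') (g : b ⟶ c) :
    M.T.map₂ (φ ▷ g) ≗ M.T.map₂ φ ▷ M.T.map g := by
  rw [M.T.map₂_whisker_right, M.T.mapComp_eq_eqToIso, M.T.mapComp_eq_eqToIso]
  simp only [eqToIso.hom, eqToIso.inv]
  exact CellEq.conj _ _ _

/-- `α : T A ⟶ A` is a strict `T`-algebra structure which is tight. -/
structure IsAlgebra {A : K} (α : M.T.obj A ⟶ A) : Prop where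
  tight : IsTight α
  unit : M.unit A ≫ α = 𝟙 A
  mult : M.T.map α ≫ α = M.mult A ≫ α

/-- The objects of `Alg_lx(T)`: strict `T`-algebras with tight structure map. -/
structure Alg where
  carrier : K
  str : M.T.obj carrier ⟶ carrier
  isAlgebra : M.IsAlgebra str

variable {M}

/-- Lax `T`-morphisms. -/
structure LaxHom (A B : M.Alg) where
  hom : A.carrier ⟶ B.carrier
  lax : M.T.map hom ≫ B.str ⟶ A.str ≫ hom
  lax_unit : M.unit A.carrier ◁ lax ≗ 𝟙 hom
  lax_mult : M.mult A.carrier ◁ lax ≗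
    M.T.map₂ lax ▷ B.str ≫
      eqToHom (by rw [M.T.map_comp, Strict.assoc]) ≫ M.T.map A.str ◁ lax

namespace LaxHom

variable {A B C D : M.Alg}

theorem ext_cellEq {f g : LaxHom A B} (h : f.hom = g.hom) (h' : f.lax ≗ g.lax) : f = g := by
  obtain ⟨f, lf, _, _⟩ := f
  obtain ⟨g, lg, _, _⟩ := g
  obtain rfl : f = g := h
  obtain rfl : lf = lg := h'.eq
  rfl

/-- A strict `T`-morphism, seen as a lax one. -/
def ofStrict {A B : M.Alg} (f : A.carrier ⟶ B.carrier) (h : M.T.map f ≫ B.str = A.str ≫ f) :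
    LaxHom A B where
  hom := f
  lax := eqToHom h
  lax_unit := by
    rw [whiskerLeft_eqToHom]
    refine (CellEq.eqToHom_left _).trans (CellEq.id_congr ?_)
    rw [h, ← Strict.assoc, A.isAlgebra.unit, Strict.id_comp]
  lax_mult := by
    rw [whiskerLeft_eqToHom, whiskerLeft_eqToHom, M.T.map₂_eqToHom, eqToHom_whiskerRight,
      eqToHom_trans, eqToHom_trans]
    refine (CellEq.eqToHom_left _).trans ((CellEq.id_congr ?_).trans (CellEq.eqToHom_left _).symm)
    rw [M.T.map_comp, Strict.assoc, B.isAlgebra.mult, ← Strict.assoc, ← Strict.assoc,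
      M.mult_natural]

/-- The laxator is an identity. -/
def IsStrict (f : LaxHom A B) : Prop := f.lax ≗ 𝟙 (M.T.map f.hom ≫ B.str)

/-- The laxator is invertible. -/
def IsPseudo (f : LaxHom A B) : Prop := IsIso f.lax

theorem IsStrict.comm {f : LaxHom A B} (h : f.IsStrict) :
    M.T.map f.hom ≫ B.str = A.str ≫ f.hom := h.2.1.symm

theorem id_aux (A : M.Alg) : M.T.map (𝟙 A.carrier) ≫ A.str = A.str ≫ 𝟙 A.carrier := by
  rw [M.T.map_id, Strict.id_comp, Strict.comp_id]

variable (A) in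
/-- The identity lax morphism. -/
def id : LaxHom A A :=
  ofStrict (𝟙 A.carrier) (id_aux A)

theorem comp_aux₁ (f : LaxHom A B) (g : LaxHom B C) :
    M.T.map (f.hom ≫ g.hom) ≫ C.str = M.T.map f.hom ≫ M.T.map g.hom ≫ C.str := by
  rw [M.T.map_comp, Strict.assoc]

/-- The pasting of two laxators, before adjusting the boundary. -/
def pasteLax (f : LaxHom A B) (g : LaxHom B C) :
    M.T.map f.hom ≫ M.T.map g.hom ≫ C.str ⟶ (A.str ≫ f.hom) ≫ g.hom :=
  M.T.map f.hom ◁ g.lax ≫ eqToHom (Strict.assoc _ _ _).symm ≫ f.lax ▷ g.hom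

theorem pasteLax_unit (f : LaxHom A B) (g : LaxHom B C) :
    M.unit A.carrier ◁ pasteLax f g ≗ 𝟙 (f.hom ≫ g.hom) := by
  have h₁ : M.unit A.carrier ◁ M.T.map f.hom ◁ g.lax ≗ 𝟙 (f.hom ≫ g.hom) := by
    refine (CellEq.comp_whiskerLeft _ _ _).symm.trans ?_
    refine (CellEq.whiskerLeft (M.unit_natural f.hom).symm (CellEq.refl _)).trans ?_
    refine (CellEq.comp_whiskerLeft _ _ _).trans ?_
    exact (CellEq.whiskerLeft rfl g.lax_unit).trans (CellEq.of_eq (whiskerLeft_id _ _))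
  have h₂ : M.unit A.carrier ◁ f.lax ▷ g.hom ≗ 𝟙 (f.hom ≫ g.hom) := by
    refine (CellEq.whisker_assoc _ _ _).symm.trans ?_
    exact (CellEq.whiskerRight f.lax_unit rfl).trans (CellEq.of_eq (id_whiskerRight _ _))
  rw [pasteLax, Bicategory.whiskerLeft_comp, Bicategory.whiskerLeft_comp, whiskerLeft_eqToHom]
  refine (CellEq.paste _ rfl h₁ h₂).trans (CellEq.of_eq (by simp))

theorem map₂_pasteLax (f : LaxHom A B) (g : LaxHom B C) :
    M.T.map₂ (pasteLax f g) ▷ C.str ≗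
      (M.T.map (M.T.map f.hom) ◁ M.T.map₂ g.lax ▷ C.str) ≫
        eqToHom (by simp only [M.T.map_comp, Strict.assoc]) ≫
          M.T.map₂ f.lax ▷ (M.T.map g.hom ≫ C.str) := by
  rw [pasteLax, M.T.map₂_comp, M.T.map₂_comp, M.T.map₂_eqToHom, Bicategory.comp_whiskerRight,
    Bicategory.comp_whiskerRight, eqToHom_whiskerRight]
  refine CellEq.paste _ _ ?_ ?_
  · refine (CellEq.whiskerRight (M.map₂_whiskerLeft _ _) rfl).trans ?_
    exact CellEq.whisker_assoc _ _ _
  · refine (CellEq.whiskerRight (M.map₂_whiskerRight _ _) rfl).trans ?_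
    exact (CellEq.whiskerRight_comp _ _ _).symm

theorem pasteLax_exchange (f : LaxHom A B) (g : LaxHom B C) :
    (M.T.map (M.T.map f.hom) ≫ M.T.map B.str) ◁ g.lax ≫
      eqToHom (by simp only [M.T.map_comp, Strict.assoc]) ≫ M.T.map₂ f.lax ▷ (B.str ≫ g.hom) ≗
    M.T.map₂ f.lax ▷ (M.T.map g.hom ≫ C.str) ≫
      eqToHom (by simp only [M.T.map_comp, Strict.assoc]) ≫
        (M.T.map A.str ≫ M.T.map f.hom) ◁ g.lax := by
  have h := whisker_exchange (M.T.map₂ f.lax) g.lax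
  refine (CellEq.paste _ rfl (CellEq.whiskerLeft (M.T.map_comp _ _).symm (CellEq.refl _))
    (CellEq.refl _)).trans ?_
  refine CellEq.trans ?_ (CellEq.paste rfl _ (CellEq.refl _)
    (CellEq.whiskerLeft (M.T.map_comp _ _) (CellEq.refl _)))
  simp only [eqToHom_refl, Category.id_comp]
  exact CellEq.of_eq h

theorem pasteLax_mult (f : LaxHom A B) (g : LaxHom B C) :
    M.mult A.carrier ◁ pasteLax f g ≗
      M.T.map₂ (pasteLax f g) ▷ C.str ≫
        eqToHom (by simp only [M.T.map_comp, Strict.assoc]) ≫ M.T.map A.str ◁ pasteLax f g := by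
  have h₁ : M.mult A.carrier ◁ M.T.map f.hom ◁ g.lax ≗
      (M.T.map (M.T.map f.hom) ◁ M.T.map₂ g.lax ▷ C.str) ≫
        eqToHom (by simp only [M.T.map_comp, Strict.assoc]) ≫
          (M.T.map (M.T.map f.hom) ≫ M.T.map B.str) ◁ g.lax := by
    refine (CellEq.comp_whiskerLeft _ _ _).symm.trans ?_
    refine (CellEq.whiskerLeft (M.mult_natural f.hom).symm (CellEq.refl _)).trans ?_
    refine (CellEq.comp_whiskerLeft _ _ _).trans ?_
    refine (CellEq.whiskerLeft rfl g.lax_mult).trans ?_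
    rw [Bicategory.whiskerLeft_comp, Bicategory.whiskerLeft_comp, whiskerLeft_eqToHom]
    exact CellEq.paste _ _ (CellEq.refl _) (CellEq.comp_whiskerLeft _ _ _).symm
  have h₂ : M.mult A.carrier ◁ f.lax ▷ g.hom ≗
      M.T.map₂ f.lax ▷ (B.str ≫ g.hom) ≫
        eqToHom (by simp only [M.T.map_comp, Strict.assoc]) ≫
          M.T.map A.str ◁ f.lax ▷ g.hom := by
    refine (CellEq.whisker_assoc _ _ _).symm.trans ?_
    refine (CellEq.whiskerRight f.lax_mult rfl).trans ?_
    rw [Bicategory.comp_whiskerRight, Bicategory.comp_whiskerRight, eqToHom_whiskerRight]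
    exact CellEq.paste _ _ (CellEq.whiskerRight_comp _ _ _).symm (CellEq.whisker_assoc _ _ _)
  have hL : M.mult A.carrier ◁ pasteLax f g = M.mult A.carrier ◁ M.T.map f.hom ◁ g.lax ≫
      eqToHom (by simp only [Strict.assoc]) ≫ M.mult A.carrier ◁ f.lax ▷ g.hom := by
    rw [pasteLax, Bicategory.whiskerLeft_comp, Bicategory.whiskerLeft_comp, whiskerLeft_eqToHom]
  have hL' := (CellEq.of_eq hL).trans
    (CellEq.paste _ (by simp only [M.T.map_comp, Strict.assoc]) h₁ h₂)
  have hR : M.T.map A.str ◁ pasteLax f g ≗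
      (M.T.map A.str ≫ M.T.map f.hom) ◁ g.lax ≫
        eqToHom (by simp only [Strict.assoc]) ≫ M.T.map A.str ◁ f.lax ▷ g.hom := by
    rw [pasteLax, Bicategory.whiskerLeft_comp, Bicategory.whiskerLeft_comp, whiskerLeft_eqToHom]
    exact CellEq.paste _ _ (CellEq.comp_whiskerLeft _ _ _).symm (CellEq.refl _)
  refine hL'.trans (CellEq.trans ?_ (CellEq.paste (by simp only [M.T.map_comp, Strict.assoc]) _
    (map₂_pasteLax f g).symm hR.symm))
  have hmid := pasteLax_exchange f g
  have key := (CellEq.refl (M.T.map (M.T.map f.hom) ◁ M.T.map₂ g.lax ▷ C.str)).paste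
    (by simp only [M.T.map_comp, Strict.assoc]) (by simp only [M.T.map_comp, Strict.assoc])
    (hmid.paste (by simp only [M.T.map_comp, Strict.assoc]) (by simp only [Strict.assoc])
      (CellEq.refl (M.T.map A.str ◁ f.lax ▷ g.hom)))
  simpa only [Category.assoc] using key

/-- Composition of lax morphisms, with the pasted laxator. -/
def comp (f : LaxHom A B) (g : LaxHom B C) : LaxHom A C where
  hom := f.hom ≫ g.hom
  lax := eqToHom (comp_aux₁ f g) ≫ pasteLax f g ≫ eqToHom (Strict.assoc _ _ _)
  lax_unit := (CellEq.whiskerLeft rfl (CellEq.conj _ _ _)).trans (pasteLax_unit f g)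
  lax_mult := by
    refine (CellEq.whiskerLeft rfl (CellEq.conj _ _ _)).trans ((pasteLax_mult f g).trans ?_)
    exact CellEq.paste _ _ (CellEq.whiskerRight (M.map₂_congr (CellEq.conj _ _ _).symm) rfl)
      (CellEq.whiskerLeft rfl (CellEq.conj _ _ _).symm)

theorem comp_lax (f : LaxHom A B) (g : LaxHom B C) : (f.comp g).lax ≗ pasteLax f g :=
  CellEq.conj _ _ _

theorem id_lax (A : M.Alg) : (id A).lax ≗ 𝟙 A.str :=
  (CellEq.eqToHom_left (id_aux A)).trans (CellEq.id_congr ((congrArg (· ≫ A.str) (M.T.map_id _)).trans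
    (Strict.id_comp _)))

theorem id_comp_lax (f : LaxHom A B) : ((id A).comp f).lax ≗ f.lax := by
  refine (comp_lax _ _).trans ?_
  have h₁ : M.T.map (id A).hom ◁ f.lax ≗ f.lax :=
    (CellEq.whiskerLeft (M.T.map_id _) (CellEq.refl _)).trans (CellEq.id_whiskerLeft _)
  have h₂ : (id A).lax ▷ f.hom ≗ 𝟙 (A.str ≫ f.hom) :=
    (CellEq.whiskerRight (id_lax A) rfl).trans (CellEq.of_eq (id_whiskerRight _ _))
  exact (h₁.paste _ rfl h₂).trans (CellEq.of_eq (by simp))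

theorem comp_id_lax (f : LaxHom A B) : (f.comp (id B)).lax ≗ f.lax := by
  refine (comp_lax _ _).trans ?_
  have h₁ : M.T.map f.hom ◁ (id B).lax ≗ 𝟙 (M.T.map f.hom ≫ B.str) :=
    (CellEq.whiskerLeft rfl (id_lax B)).trans (CellEq.of_eq (whiskerLeft_id _ _))
  have h₂ : f.lax ▷ (id B).hom ≗ f.lax := CellEq.whiskerRight_id _
  exact (h₁.paste _ rfl h₂).trans (CellEq.of_eq (by simp))

theorem assoc_lax (f : LaxHom A B) (g : LaxHom B C) (h : LaxHom C D) :
    ((f.comp g).comp h).lax ≗ (f.comp (g.comp h)).lax := by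
  refine (comp_lax _ _).trans (CellEq.trans ?_ (comp_lax _ _).symm)
  have l : (f.comp g).lax ▷ h.hom ≗
      (M.T.map f.hom ◁ g.lax ▷ h.hom) ≫ eqToHom (by simp only [Strict.assoc]) ≫
        f.lax ▷ (g.hom ≫ h.hom) := by
    refine (CellEq.whiskerRight (comp_lax _ _) rfl).trans ?_
    rw [pasteLax, Bicategory.comp_whiskerRight, Bicategory.comp_whiskerRight, eqToHom_whiskerRight]
    exact CellEq.paste _ _ (CellEq.whisker_assoc _ _ _) (CellEq.whiskerRight_comp _ _ _).symm
  have r : M.T.map f.hom ◁ (g.comp h).lax ≗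
      ((M.T.map f.hom ≫ M.T.map g.hom) ◁ h.lax) ≫ eqToHom (by simp only [Strict.assoc]) ≫
        M.T.map f.hom ◁ g.lax ▷ h.hom := by
    refine (CellEq.whiskerLeft rfl (comp_lax _ _)).trans ?_
    rw [pasteLax, Bicategory.whiskerLeft_comp, Bicategory.whiskerLeft_comp, whiskerLeft_eqToHom]
    exact CellEq.paste _ _ (CellEq.comp_whiskerLeft _ _ _).symm (CellEq.refl _)
  have s : M.T.map (f.comp g).hom ◁ h.lax ≗ (M.T.map f.hom ≫ M.T.map g.hom) ◁ h.lax :=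
    CellEq.whiskerLeft (M.T.map_comp _ _) (CellEq.refl _)
  refine (CellEq.paste _ (by simp only [Strict.assoc]) s l).trans
    (CellEq.trans ?_ (CellEq.paste (by simp only [Strict.assoc]; rfl) _ r.symm (CellEq.refl _)))
  simp only [Category.assoc]
  exact CellEq.refl _

end LaxHom

/-- `T`-2-morphisms between lax morphisms. -/
@[ext]
structure LaxCell {A B : M.Alg} (f g : LaxHom A B) where
  cell : f.hom ⟶ g.hom
  comm : f.lax ≫ A.str ◁ cell = M.T.map₂ cell ▷ B.str ≫ g.lax

instance (A B : M.Alg) : Category (LaxHom A B) where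
  Hom f g := LaxCell f g
  id f := ⟨𝟙 f.hom, by simp⟩
  comp σ τ := ⟨σ.cell ≫ τ.cell, by
    rw [Bicategory.whiskerLeft_comp, ← Category.assoc, σ.comm, Category.assoc, τ.comm,
      M.T.map₂_comp, Bicategory.comp_whiskerRight, Category.assoc]⟩
  id_comp σ := LaxCell.ext (Category.id_comp _)
  comp_id σ := LaxCell.ext (Category.comp_id _)
  assoc σ τ ρ := LaxCell.ext (Category.assoc _ _ _)

namespace LaxCell

variable {A B C D : M.Alg}

theorem hom_ext {f g : LaxHom A B} {σ τ : f ⟶ g} (h : σ.cell = τ.cell) : σ = τ := LaxCell.ext h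

theorem pasteLax_whiskerLeft (f : LaxHom A B) {g h : LaxHom B C} (σ : g ⟶ h) :
    f.pasteLax g ≫ (A.str ≫ f.hom) ◁ σ.cell =
      (M.T.map f.hom ◁ M.T.map₂ σ.cell ▷ C.str) ≫ f.pasteLax h := by
  have e : eqToHom (Strict.assoc _ _ _).symm ≫ (M.T.map f.hom ≫ B.str) ◁ σ.cell =
      M.T.map f.hom ◁ B.str ◁ σ.cell ≫ eqToHom (Strict.assoc _ _ _).symm :=
    ((CellEq.eqToHom_comp _ _).trans ((CellEq.comp_whiskerLeft _ _ _).trans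
      (CellEq.comp_eqToHom _ _).symm)).eq
  simp only [LaxHom.pasteLax, Category.assoc]
  rw [← whisker_exchange, reassoc_of% e,
    ← Bicategory.whiskerLeft_comp_assoc, σ.comm, Bicategory.whiskerLeft_comp_assoc]

theorem pasteLax_whiskerRight {f g : LaxHom A B} (σ : f ⟶ g) (h : LaxHom B C) :
    f.pasteLax h ≫ (A.str ◁ σ.cell) ▷ h.hom =
      M.T.map₂ σ.cell ▷ (M.T.map h.hom ≫ C.str) ≫ g.pasteLax h := by
  have e : eqToHom (Strict.assoc _ _ _).symm ≫ M.T.map₂ σ.cell ▷ B.str ▷ h.hom =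
      M.T.map₂ σ.cell ▷ (B.str ≫ h.hom) ≫ eqToHom (Strict.assoc _ _ _).symm :=
    ((CellEq.eqToHom_comp _ _).trans ((CellEq.whiskerRight_comp _ _ _).symm.trans
      (CellEq.comp_eqToHom _ _).symm)).eq
  simp only [LaxHom.pasteLax, Category.assoc]
  rw [← Bicategory.comp_whiskerRight, σ.comm, Bicategory.comp_whiskerRight,
    reassoc_of% e, whisker_exchange_assoc]

/-- Whiskering on the left. -/
def whiskerLeft (f : LaxHom A B) {g h : LaxHom B C} (σ : g ⟶ h) : f.comp g ⟶ f.comp h where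
  cell := f.hom ◁ σ.cell
  comm := by
    refine CellEq.eq (((LaxHom.comp_lax f g).comp (CellEq.comp_whiskerLeft _ _ _).symm).trans
      ((CellEq.of_eq (pasteLax_whiskerLeft f σ)).trans
        (CellEq.comp ?_ (LaxHom.comp_lax f h).symm)))
    exact (CellEq.whisker_assoc _ _ _).symm.trans
      (CellEq.whiskerRight (M.map₂_whiskerLeft _ _).symm rfl)

/-- Whiskering on the right. -/
def whiskerRight {f g : LaxHom A B} (σ : f ⟶ g) (h : LaxHom B C) : f.comp h ⟶ g.comp h where
  cell := σ.cell ▷ h.hom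
  comm := by
    refine CellEq.eq (((LaxHom.comp_lax f h).comp (CellEq.whisker_assoc _ _ _).symm).trans
      ((CellEq.of_eq (pasteLax_whiskerRight σ h)).trans
        (CellEq.comp ?_ (LaxHom.comp_lax g h).symm)))
    exact (CellEq.whiskerRight_comp _ _ _).trans
      (CellEq.whiskerRight (M.map₂_whiskerRight _ _).symm rfl)

theorem comm_of_id {f g : LaxHom A B} (h : f.lax ≗ g.lax) {φ : f.hom ⟶ g.hom}
    (hφ : φ ≗ 𝟙 f.hom) : f.lax ≫ A.str ◁ φ = M.T.map₂ φ ▷ B.str ≫ g.lax := by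
  have h₁ : A.str ◁ φ ≗ 𝟙 (A.str ≫ f.hom) :=
    (CellEq.whiskerLeft rfl hφ).trans (CellEq.of_eq (whiskerLeft_id _ _))
  have h₂ : M.T.map₂ φ ▷ B.str ≗ 𝟙 (M.T.map g.hom ≫ B.str) :=
    (CellEq.whiskerRight (M.map₂_congr (hφ.trans (CellEq.id_congr hφ.2.1.symm))) rfl).trans
      (CellEq.of_eq (by simp))
  refine CellEq.eq (CellEq.trans ((CellEq.refl f.lax).comp h₁) ?_)
  refine CellEq.trans ?_ (h₂.comp (CellEq.refl g.lax)).symm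
  rw [Category.comp_id, Category.id_comp]
  exact h

/-- The isomorphism of lax morphisms underlain by an identity 2-cell. -/
def isoOfId {f g : LaxHom A B} (h : f.lax ≗ g.lax) (φ : f.hom ≅ g.hom)
    (hφ : φ.hom ≗ 𝟙 f.hom) (hφ' : φ.inv ≗ 𝟙 g.hom) : f ≅ g where
  hom := ⟨φ.hom, comm_of_id h hφ⟩
  inv := ⟨φ.inv, comm_of_id h.symm hφ'⟩
  hom_inv_id := hom_ext φ.hom_inv_id
  inv_hom_id := hom_ext φ.inv_hom_id

end LaxCell

set_option linter.unusedVariables false in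
/-- The 2-category `Alg_lx(T)` of strict `T`-algebras with tight structure map, lax `T`-morphisms
and `T`-2-morphisms. -/
instance algBicategory : Bicategory M.Alg where
  Hom A B := LaxHom A B
  id A := LaxHom.id A
  comp f g := f.comp g
  homCategory A B := inferInstance
  whiskerLeft f _ _ σ := LaxCell.whiskerLeft f σ
  whiskerRight σ h := LaxCell.whiskerRight σ h
  associator f g h := LaxCell.isoOfId (f.assoc_lax g h) (α_ f.hom g.hom h.hom)
    (CellEq.eqToIso_hom_id (Strict.associator_eqToIso _ _ _))
    (CellEq.eqToIso_inv_id (Strict.associator_eqToIso _ _ _))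
  leftUnitor f := LaxCell.isoOfId f.id_comp_lax (λ_ f.hom)
    (CellEq.eqToIso_hom_id (Strict.leftUnitor_eqToIso _))
    (CellEq.eqToIso_inv_id (Strict.leftUnitor_eqToIso _))
  rightUnitor f := LaxCell.isoOfId f.comp_id_lax (ρ_ f.hom)
    (CellEq.eqToIso_hom_id (Strict.rightUnitor_eqToIso _))
    (CellEq.eqToIso_inv_id (Strict.rightUnitor_eqToIso _))
  whiskerLeft_id f g := LaxCell.hom_ext (Bicategory.whiskerLeft_id _ _)
  whiskerLeft_comp f _ _ _ σ τ := LaxCell.hom_ext (Bicategory.whiskerLeft_comp _ _ _)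
  id_whiskerLeft σ := LaxCell.hom_ext (Bicategory.id_whiskerLeft _)
  comp_whiskerLeft f g _ _ σ := LaxCell.hom_ext (Bicategory.comp_whiskerLeft _ _ _)
  id_whiskerRight f g := LaxCell.hom_ext (Bicategory.id_whiskerRight _ _)
  comp_whiskerRight σ τ h := LaxCell.hom_ext (Bicategory.comp_whiskerRight _ _ _)
  whiskerRight_id σ := LaxCell.hom_ext (Bicategory.whiskerRight_id _)
  whiskerRight_comp σ g h := LaxCell.hom_ext (Bicategory.whiskerRight_comp _ _ _)
  whisker_assoc f _ _ σ h := LaxCell.hom_ext (Bicategory.whisker_assoc _ _ _)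
  whisker_exchange σ τ := LaxCell.hom_ext (Bicategory.whisker_exchange _ _)
  pentagon f g h i := LaxCell.hom_ext (Bicategory.pentagon _ _ _ _)
  triangle f g := LaxCell.hom_ext (Bicategory.triangle _ _)

theorem LaxCell.eqToIso_cell {A B : M.Alg} {f g : A ⟶ B} (h : f = g) :
    LaxCell.cell (eqToIso h).hom =
      (eqToIso (congrArg (LaxHom.hom (A := A) (B := B)) h)).hom := by
  subst h
  rfl

instance algStrict : Bicategory.Strict M.Alg where
  id_comp f := LaxHom.ext_cellEq (Strict.id_comp _) (LaxHom.id_comp_lax f)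
  comp_id f := LaxHom.ext_cellEq (Strict.comp_id _) (LaxHom.comp_id_lax f)
  assoc f g h := LaxHom.ext_cellEq (Strict.assoc _ _ _) (LaxHom.assoc_lax f g h)
  leftUnitor_eqToIso f := Iso.ext (LaxCell.hom_ext (Eq.trans
    (congrArg Iso.hom (Strict.leftUnitor_eqToIso _))
    (LaxCell.eqToIso_cell (f := 𝟙 _ ≫ f) (g := f) (LaxHom.ext_cellEq
      (Strict.id_comp _) (LaxHom.id_comp_lax f))).symm))
  rightUnitor_eqToIso f := Iso.ext (LaxCell.hom_ext (Eq.trans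
    (congrArg Iso.hom (Strict.rightUnitor_eqToIso _))
    (LaxCell.eqToIso_cell (f := f ≫ 𝟙 _) (g := f) (LaxHom.ext_cellEq
      (Strict.comp_id _) (LaxHom.comp_id_lax f))).symm))
  associator_eqToIso f g h := Iso.ext (LaxCell.hom_ext (Eq.trans
    (congrArg Iso.hom (Strict.associator_eqToIso _ _ _))
    (LaxCell.eqToIso_cell (f := (f ≫ g) ≫ h) (g := f ≫ g ≫ h) (LaxHom.ext_cellEq
      (Strict.assoc _ _ _) (LaxHom.assoc_lax f g h))).symm))

theorem LaxHom.isStrict_comp {A B C : M.Alg} {f : LaxHom A B} {g : LaxHom B C}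
    (hf : f.IsStrict) (hg : g.IsStrict) : (f.comp g).IsStrict := by
  have h₁ : M.T.map f.hom ◁ g.lax ≗ 𝟙 (M.T.map f.hom ≫ M.T.map g.hom ≫ C.str) :=
    (CellEq.whiskerLeft rfl hg).trans (CellEq.of_eq (whiskerLeft_id _ _))
  have h₂ : f.lax ▷ g.hom ≗ 𝟙 (M.T.map f.hom ≫ M.T.map g.hom ≫ C.str) :=
    (CellEq.whiskerRight hf rfl).trans ((CellEq.of_eq (id_whiskerRight _ _)).trans
      (CellEq.id_congr (by rw [Strict.assoc, hg.comm])))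
  refine (LaxHom.comp_lax f g).trans ((h₁.paste _ rfl h₂).trans ?_)
  refine (CellEq.of_eq (by simp)).trans (CellEq.id_congr (LaxHom.comp_aux₁ f g).symm)

/-- The tight 1-cells of `Alg_lx(T)` are the strict morphisms which are tight in `K`. -/
instance algEnhancement : Enhancement M.Alg where
  IsTight {A B} f := LaxHom.IsStrict (A := A) (B := B) f ∧ IsTight (LaxHom.hom f)
  id_tight A := ⟨CellEq.eqToHom_left (LaxHom.id_aux A), Enhancement.id_tight _⟩
  comp_tight _ _ hf hg := ⟨LaxHom.isStrict_comp hf.1 hg.1,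
    Enhancement.comp_tight _ _ hf.2 hg.2⟩

theorem isStrict_of_isTight {A B : M.Alg} {f : A ⟶ B} (h : IsTight f) :
    LaxHom.IsStrict (A := A) (B := B) f := h.1

/-! ## Cartesianity and the hypotheses on `T` -/

/-- The `T`-cartesianity defect `T E ⟶ β^* E` of a strict `T`-morphism `p : (E, η) ⟶ (B, β)`: the
comparison, with components `η` and `T p`, into a pullback of `p` along `β`. -/
noncomputable def cartesianityDefect {E B : M.Alg} (p : LaxHom E B) (hp : p.IsStrict) {P : K}
    {top : P ⟶ E.carrier} {left : P ⟶ M.T.obj B.carrier}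
    (sq : IsTwoPullback top left p.hom B.str) : M.T.obj E.carrier ⟶ P :=
  sq.lift E.str (M.T.map p.hom) hp.comm.symm

/-- A strict `T`-morphism `p : (E, η) ⟶ (B, β)` is `T`-cartesian when the pullback of `p` along `β`
exists and the `T`-cartesianity defect is a split equivalence. -/
def IsTCartesian {E B : M.Alg} (p : LaxHom E B) (hp : p.IsStrict) : Prop :=
  ∃ (P : K) (top : P ⟶ E.carrier) (left : P ⟶ M.T.obj B.carrier)
    (sq : IsTwoPullback top left p.hom B.str), IsSplitEquivalence (cartesianityDefect p hp sq)

/-- The hypotheses on an enhanced 2-monad with respect to a 2-classifier `u : Ω' ⟶ Ω`: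
`T u` is small, with tight classifying map `ω` (exhibited by `ω'`), `T` preserves pullbacks of `u`,
the unit and the multiplication are cartesian at `u`, and `(Ω, ω)` is a strict `T`-algebra. -/
structure LiftingHypotheses (S : SmallClass K) (M : EnhancedMonad K) {Ω' Ω : K} (u : Ω' ⟶ Ω)
    (ω' : M.T.obj Ω' ⟶ Ω') (ω : M.T.obj Ω ⟶ Ω) : Prop where
  small_map : S.Small (M.T.map u)
  classifies : IsLeftTightPullback ω' (M.T.map u) u ω
  preserves_pullback : ∀ {P B : K} {top : P ⟶ Ω'} {left : P ⟶ B} {f : B ⟶ Ω},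
    IsLeftTightPullback top left u f →
      IsTwoPullback (M.T.map top) (M.T.map left) (M.T.map u) (M.T.map f)
  unit_cartesian : IsTwoPullback (M.unit Ω') u (M.T.map u) (M.unit Ω)
  mult_cartesian : IsTwoPullback (M.mult Ω') (M.T.map (M.T.map u)) (M.T.map u) (M.mult Ω)
  tight : IsTight ω
  unit : M.unit Ω ≫ ω = 𝟙 Ω
  mult : M.T.map ω ≫ ω = M.mult Ω ≫ ω

namespace LiftingHypotheses

variable {S : SmallClass K} {Ω' Ω : K} {u : Ω' ⟶ Ω} {ω' : M.T.obj Ω' ⟶ Ω'}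
  {ω : M.T.obj Ω ⟶ Ω}

/-- The `T`-algebra `(Ω, ω)`. -/
def algΩ (h : LiftingHypotheses S M u ω' ω) : M.Alg := ⟨Ω, ω, h.tight, h.unit, h.mult⟩

/-- The strict `T`-morphism `u : (Ω', ω') ⟶ (Ω, ω)`. -/
def algU (h : LiftingHypotheses S M u ω' ω) (h' : M.IsAlgebra ω') :
    (⟨Ω', ω', h'⟩ : M.Alg) ⟶ h.algΩ :=
  LaxHom.ofStrict u h.classifies.w.symm

end LiftingHypotheses

end EnhancedMonad

/-! Full faithfulness of the 2-classifier says that a 2-cell between maps `f, f' : B ⟶ Ω` is the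
same thing as a map over `B` between the pullbacks of `u` along `f` and `f'`
(`IsTwoClassifier.exists_cell`, `IsTwoClassifier.cell_ext`). Let `g` classify the underlying map of
`p : (E, η) ⟶ (B, β)`. Then `T g ≫ ω` classifies `T p`, because `T` preserves pullbacks of `u`,
while `β ≫ g` classifies `β^* p`. The cartesianity defect `T E ⟶ β^* E` therefore names a 2-cell `T
g ≫ ω ⟶ β ≫ g`. This is the laxator of `dp`, and its axioms are the algebra laws of `η` read through
the same bijection. The laxator is invertible exactly when the defect is an isomorphism
(`IsTwoClassifier.isIso_iff`). Since `T p` is a discrete opfibration, that is equivalent to being a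
split equivalence (`IsDiscOpfib.isSplitEquivalence_iff`).

Two points need a further idea. The laws for `ω'` hold after composing with `u`, but a pullback
square may have several top sides over the same classifying map. Here there is only one: the
identity of the terminal object is classified by a point of `Ω`, and `Ω'` receives a 2-cell from the
constant map at that point to its identity, which forces the relevant endomorphisms to act trivially
(`exists_point`, `top_eq`).

The other point is that `Classifies` for algebras refers to pullbacks of lax morphisms. Strict
discrete opfibrations lift laxators uniquely, so a square that is a pullback in `K` is one for
algebras (`isTwoPullback_of_underlying`). Conversely, the pullback of `u` in `K` along a lax
morphism carries an algebra structure, so any algebra pullback is isomorphic to it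
(`isTwoPullback_underlying`). -/

/-! ### Calculus of bundled 2-cells -/

/-- A 2-cell bundled with its boundary, so that `CellEq` becomes equality. -/
structure TwoCell {K : Type u} [Bicategory.{w, v} K] (a b : K) where
  src : a ⟶ b
  tgt : a ⟶ b
  hom : src ⟶ tgt

namespace TwoCell

variable {K : Type u} [Bicategory.{w, v} K] {a b c d : K}

/-- The bundled 2-cell underlain by `φ`. -/
@[simps] def of {f g : a ⟶ b} (φ : f ⟶ g) : TwoCell a b := ⟨f, g, φ⟩

theorem of_eq_of {f g f' g' : a ⟶ b} {φ : f ⟶ g} {ψ : f' ⟶ g'} : of φ = of ψ ↔ φ ≗ ψ := by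
  constructor
  · intro h
    simp only [of, mk.injEq] at h
    exact h
  · rintro ⟨rfl, rfl, h⟩
    rw [eq_of_heq h]

/-- The identity 2-cell. -/
@[simps] def one (f : a ⟶ b) : TwoCell a b := ⟨f, f, 𝟙 f⟩

/-- Vertical composition. -/
@[simps] def comp (X Y : TwoCell a b) (h : X.tgt = Y.src) : TwoCell a b :=
  ⟨X.src, Y.tgt, X.hom ≫ eqToHom h ≫ Y.hom⟩

/-- Whiskering on the left. -/
@[simps] def lw (f : a ⟶ b) (X : TwoCell b c) : TwoCell a c := ⟨f ≫ X.src, f ≫ X.tgt, f ◁ X.hom⟩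

/-- Whiskering on the right. -/
@[simps] def rw (X : TwoCell a b) (g : b ⟶ c) : TwoCell a c := ⟨X.src ≫ g, X.tgt ≫ g, X.hom ▷ g⟩

theorem of_eqToHom {f g : a ⟶ b} (h : f = g) : of (eqToHom h) = one f := by
  subst h; rfl

theorem of_comp {f g h : a ⟶ b} (φ : f ⟶ g) (ψ : g ⟶ h) :
    of (φ ≫ ψ) = (of φ).comp (of ψ) rfl := by
  change _ = (⟨f, h, φ ≫ eqToHom rfl ≫ ψ⟩ : TwoCell a b)
  rw [eqToHom_refl, Category.id_comp]
  rfl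

theorem of_whiskerRight {f g : a ⟶ b} (φ : f ⟶ g) (h : b ⟶ c) : of (φ ▷ h) = rw (of φ) h := rfl

theorem exists_hom (X : TwoCell a b) {f g : a ⟶ b} (hf : X.src = f) (hg : X.tgt = g) :
    ∃ φ : f ⟶ g, of φ = X := by
  subst hf hg; exact ⟨X.hom, rfl⟩

theorem of_injective {f g : a ⟶ b} {φ ψ : f ⟶ g} (h : of φ = of ψ) : φ = ψ :=
  (of_eq_of.1 h).eq

@[simp] theorem one_comp (f : a ⟶ b) (X : TwoCell a b) (h : (one f).tgt = X.src) :
    (one f).comp X h = X := by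
  obtain ⟨s, t, φ⟩ := X
  obtain rfl : f = s := h
  simp [comp, one]

@[simp] theorem comp_one (f : a ⟶ b) (X : TwoCell a b) (h : X.tgt = (one f).src) :
    X.comp (one f) h = X := by
  obtain ⟨s, t, φ⟩ := X
  obtain rfl : t = f := h
  simp [comp, one]

@[simp] theorem lw_one (f : a ⟶ b) (g : b ⟶ c) : lw f (one g) = one (f ≫ g) := by
  simp [lw, one]

@[simp] theorem rw_one (f : a ⟶ b) (g : b ⟶ c) : rw (one f) g = one (f ≫ g) := by
  simp [rw, one]

theorem lw_comp (f : a ⟶ b) (X Y : TwoCell b c) (h : X.tgt = Y.src) :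
    lw f (X.comp Y h) = (lw f X).comp (lw f Y) (congrArg (f ≫ ·) h) := by
  simp [lw, comp]

theorem rw_comp (X Y : TwoCell a b) (h : X.tgt = Y.src) (g : b ⟶ c) :
    rw (X.comp Y h) g = (rw X g).comp (rw Y g) (congrArg (· ≫ g) h) := by
  simp [rw, comp]

theorem comp_congr {X X' Y Y' : TwoCell a b} {h : X.tgt = Y.src} (hX : X = X') (hY : Y = Y') :
    X.comp Y h = X'.comp Y' (hX ▸ hY ▸ h) := by
  subst hX hY; rfl

/-- The interchange law. -/
theorem exchange (X : TwoCell a b) (Y : TwoCell b c) :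
    (lw X.src Y).comp (rw X Y.tgt) rfl = (rw X Y.src).comp (lw X.tgt Y) rfl := by
  simp [lw, comp, rw, whisker_exchange]

variable [Bicategory.Strict K]

@[simp] theorem lw_lw (f : a ⟶ b) (g : b ⟶ c) (X : TwoCell c d) :
    lw f (lw g X) = lw (f ≫ g) X :=
  (of_eq_of.2 (CellEq.comp_whiskerLeft f g X.hom)).symm

@[simp] theorem rw_rw (X : TwoCell a b) (g : b ⟶ c) (h : c ⟶ d) :
    rw (rw X g) h = rw X (g ≫ h) :=
  (of_eq_of.2 (CellEq.whiskerRight_comp X.hom g h)).symm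

@[simp] theorem lw_rw (f : a ⟶ b) (X : TwoCell b c) (h : c ⟶ d) :
    rw (lw f X) h = lw f (rw X h) :=
  of_eq_of.2 (CellEq.whisker_assoc f X.hom h)

@[simp] theorem id_lw (X : TwoCell a b) : lw (𝟙 a) X = X :=
  of_eq_of.2 (CellEq.id_whiskerLeft X.hom)

@[simp] theorem rw_id (X : TwoCell a b) : rw X (𝟙 b) = X :=
  of_eq_of.2 (CellEq.whiskerRight_id X.hom)

variable [Enhancement K]

/-- The action of `T` on bundled 2-cells. -/
@[simps] def map (M : EnhancedMonad K) (X : TwoCell a b) : TwoCell (M.T.obj a) (M.T.obj b) :=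
  ⟨M.T.map X.src, M.T.map X.tgt, M.T.map₂ X.hom⟩

variable (M : EnhancedMonad K)

theorem map_comp (X Y : TwoCell a b) (h : X.tgt = Y.src) :
    map M (X.comp Y h) = (map M X).comp (map M Y) (congrArg M.T.map h) := by
  simp [map, comp, M.T.map₂_eqToHom]

@[simp] theorem map_lw (f : a ⟶ b) (X : TwoCell b c) :
    map M (lw f X) = lw (M.T.map f) (map M X) :=
  of_eq_of.2 (M.map₂_whiskerLeft f X.hom)

@[simp] theorem map_rw (X : TwoCell a b) (g : b ⟶ c) :
    map M (rw X g) = rw (map M X) (M.T.map g) :=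
  of_eq_of.2 (M.map₂_whiskerRight X.hom g)

theorem unit_natural (X : TwoCell a b) : rw X (M.unit b) = lw (M.unit a) (map M X) :=
  of_eq_of.2 (M.unit_natural₂ X.hom)

theorem mult_natural (X : TwoCell a b) :
    rw (map M (map M X)) (M.mult b) = lw (M.mult a) (map M X) :=
  of_eq_of.2 (M.mult_natural₂ X.hom)

end TwoCell

/-! ### Discrete opfibrations and 2-pullbacks -/

section Pullbacks

variable {K : Type u} [Bicategory.{w, v} K]

open TwoCell

namespace IsDiscOpfib

variable {E B X : K} {p : E ⟶ B}

/-- Lifting of 2-cells along a discrete opfibration. -/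
theorem exists_lift (hp : IsDiscOpfib p) (e : X ⟶ E) (Φ : TwoCell X B) (h : e ≫ p = Φ.src) :
    ∃ Λ : TwoCell X E, Λ.src = e ∧ rw Λ p = Φ := by
  obtain ⟨s, t, φ⟩ := Φ
  obtain rfl : e ≫ p = s := h
  obtain ⟨⟨e', l⟩, hl, -⟩ := hp e t φ
  exact ⟨of l, rfl, of_eq_of.2 hl⟩

/-- Lifts of 2-cells along a discrete opfibration are unique. -/
theorem eq_of_rw_eq (hp : IsDiscOpfib p) {Λ M : TwoCell X E} (hs : Λ.src = M.src)
    (h : rw Λ p = rw M p) : Λ = M := by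
  obtain ⟨s, t, φ⟩ := Λ
  obtain ⟨s', t', ψ⟩ := M
  obtain rfl : s = s' := hs
  have := (hp s _ (ψ ▷ p)).unique (y₁ := ⟨t, φ⟩) (y₂ := ⟨t', ψ⟩)
    (of_eq_of.1 h) (CellEq.refl _)
  cases this
  rfl

/-- Replaces the chosen codomain of a lift by the existence of some lift, so that later arguments
never unfold the choice. -/
theorem push_eq_iff (hp : IsDiscOpfib p) (e : X ⟶ E) {b : X ⟶ B} (φ : e ≫ p ⟶ b) (e' : X ⟶ E) :
    hp.push e φ = e' ↔ ∃ Λ : TwoCell X E, Λ.src = e ∧ Λ.tgt = e' ∧ rw Λ p = of φ := by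
  have hc := (hp e b φ).choose_spec.1
  constructor
  · rintro rfl
    exact ⟨of (hp e b φ).choose.2, rfl, rfl, of_eq_of.2 hc⟩
  · rintro ⟨Λ, h₁, rfl, h₃⟩
    exact congrArg TwoCell.tgt (hp.eq_of_rw_eq (Λ := of (hp e b φ).choose.2) (M := Λ) h₁.symm
      ((of_eq_of.2 hc).trans h₃.symm))

end IsDiscOpfib

namespace IsTwoPullback

variable {P E A B X : K} {top : P ⟶ E} {left : P ⟶ A} {p : E ⟶ B} {f : A ⟶ B}

theorem hom_ext (sq : IsTwoPullback top left p f) {h k : X ⟶ P} (h₁ : h ≫ top = k ≫ top)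
    (h₂ : h ≫ left = k ≫ left) [Bicategory.Strict K] : h = k :=
  (sq.existsUnique_lift (k ≫ top) (k ≫ left)
    (by rw [Strict.assoc, Strict.assoc, sq.w])).unique ⟨h₁, h₂⟩ ⟨rfl, rfl⟩

variable [Bicategory.Strict K]

theorem existsUnique_cell (sq : IsTwoPullback top left p f) (Φ : TwoCell X E) (Ψ : TwoCell X A)
    (h : rw Φ p = rw Ψ f) : ∃! Θ : TwoCell X P, rw Θ top = Φ ∧ rw Θ left = Ψ := by
  obtain ⟨s, t, φ⟩ := Φ
  obtain ⟨s', t', ψ⟩ := Ψ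
  obtain ⟨k, ⟨rfl, rfl⟩, -⟩ := sq.existsUnique_lift s s' (congrArg TwoCell.src h)
  obtain ⟨l, ⟨rfl, rfl⟩, -⟩ := sq.existsUnique_lift t t' (congrArg TwoCell.tgt h)
  obtain ⟨θ, ⟨rfl, rfl⟩, hθ⟩ := sq.existsUnique_lift₂ k l φ ψ (of_eq_of.1 h)
  refine ⟨of θ, ⟨rfl, rfl⟩, ?_⟩
  rintro ⟨k', l', θ'⟩ ⟨h₁, h₂⟩
  obtain rfl : k' = k := sq.hom_ext (congrArg TwoCell.src h₁) (congrArg TwoCell.src h₂)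
  obtain rfl : l' = l := sq.hom_ext (congrArg TwoCell.tgt h₁) (congrArg TwoCell.tgt h₂)
  rw [hθ θ' ⟨of_injective h₁, of_injective h₂⟩]
  rfl

theorem cell_ext (sq : IsTwoPullback top left p f) {Θ Θ' : TwoCell X P}
    (h₁ : rw Θ top = rw Θ' top) (h₂ : rw Θ left = rw Θ' left) : Θ = Θ' :=
  (sq.existsUnique_cell (rw Θ' top) (rw Θ' left)
    (by rw [rw_rw, rw_rw, sq.w])).unique ⟨h₁, h₂⟩ ⟨rfl, rfl⟩

/-- With bundled 2-cells the two-dimensional universal property has the same shape as the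
one-dimensional one, so each closure property below is proved by running one argument twice. -/
theorem of_cells (comm : top ≫ p = left ≫ f)
    (lift : ∀ ⦃X : K⦄ (e : X ⟶ E) (a : X ⟶ A), e ≫ p = a ≫ f →
      ∃! h : X ⟶ P, h ≫ top = e ∧ h ≫ left = a)
    (lift₂ : ∀ ⦃X : K⦄ (Φ : TwoCell X E) (Ψ : TwoCell X A), rw Φ p = rw Ψ f →
      ∃! Θ : TwoCell X P, rw Θ top = Φ ∧ rw Θ left = Ψ) : IsTwoPullback top left p f := by
  refine ⟨comm, lift, fun X h k σ τ e => ?_⟩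
  obtain ⟨Θ, ⟨h₁, h₂⟩, hu⟩ := lift₂ (of σ) (of τ) (of_eq_of.2 e)
  have uniq : ∀ h k : X ⟶ P, h ≫ top = k ≫ top → h ≫ left = k ≫ left → h = k :=
    fun h k e₁ e₂ => (lift (k ≫ top) (k ≫ left)
      (by rw [Strict.assoc, Strict.assoc, comm])).unique ⟨e₁, e₂⟩ ⟨rfl, rfl⟩
  obtain ⟨θ, rfl⟩ := Θ.exists_hom (uniq _ h (congrArg TwoCell.src h₁) (congrArg TwoCell.src h₂))
    (uniq _ k (congrArg TwoCell.tgt h₁) (congrArg TwoCell.tgt h₂))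
  exact ⟨θ, ⟨of_injective h₁, of_injective h₂⟩, fun θ' hθ => of_injective
    (hu (of θ') ⟨congrArg of hθ.1, congrArg of hθ.2⟩)⟩

/-- The pasting of two pullback squares along a common side. -/
theorem paste (sq : IsTwoPullback top left p f) {E' B' : K} {top' : E ⟶ E'} {p' : E' ⟶ B'}
    {f' : B ⟶ B'} (sq' : IsTwoPullback top' p p' f') :
    IsTwoPullback (top ≫ top') left p' (f ≫ f') := by
  refine of_cells ?_ ?_ ?_
  · rw [Strict.assoc, sq'.w, ← Strict.assoc, sq.w, Strict.assoc]
  · intro X e a h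
    obtain ⟨e₁, ⟨h₁, h₂⟩, -⟩ := sq'.existsUnique_lift e (a ≫ f) (by rw [h, Strict.assoc])
    obtain ⟨k, ⟨h₃, h₄⟩, -⟩ := sq.existsUnique_lift e₁ a h₂
    refine ⟨k, ⟨by rw [← Strict.assoc, h₃, h₁], h₄⟩, fun k' ⟨h₅, h₆⟩ => ?_⟩
    refine sq.hom_ext (sq'.hom_ext ?_ ?_) (h₆.trans h₄.symm)
    · rw [Strict.assoc, h₅, h₃, h₁]
    · rw [Strict.assoc, Strict.assoc, sq.w, ← Strict.assoc, ← Strict.assoc, h₆, h₄]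
  · intro X Φ Ψ h
    obtain ⟨Φ₁, ⟨h₁, h₂⟩, -⟩ := sq'.existsUnique_cell Φ (rw Ψ f) (by rw [h, rw_rw])
    obtain ⟨Θ, ⟨h₃, h₄⟩, -⟩ := sq.existsUnique_cell Φ₁ Ψ h₂
    refine ⟨Θ, ⟨by rw [← rw_rw, h₃, h₁], h₄⟩, fun Θ' ⟨h₅, h₆⟩ => ?_⟩
    refine sq.cell_ext (sq'.cell_ext ?_ ?_) (h₆.trans h₄.symm)
    · rw [rw_rw, h₅, h₃, h₁]
    · rw [rw_rw, rw_rw, sq.w, ← rw_rw, ← rw_rw, h₆, h₄]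

/-- Pullback squares are invariant under isomorphism. -/
theorem of_iso (sq : IsTwoPullback top left p f) {Q : K} {c : Q ⟶ P} {d : P ⟶ Q}
    (hcd : c ≫ d = 𝟙 Q) (hdc : d ≫ c = 𝟙 P) : IsTwoPullback (c ≫ top) (c ≫ left) p f := by
  refine of_cells ?_ ?_ ?_
  · rw [Strict.assoc, Strict.assoc, sq.w]
  · intro X e a h
    obtain ⟨k, ⟨h₁, h₂⟩, hu⟩ := sq.existsUnique_lift e a h
    have hk : (k ≫ d) ≫ c = k := by rw [Strict.assoc, hdc, Strict.comp_id]
    refine ⟨k ≫ d, ⟨by rw [← Strict.assoc, hk, h₁], by rw [← Strict.assoc, hk, h₂]⟩, ?_⟩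
    rintro k' ⟨h₃, h₄⟩
    rw [← hu (k' ≫ c) ⟨by rw [Strict.assoc, h₃], by rw [Strict.assoc, h₄]⟩, Strict.assoc, hcd,
      Strict.comp_id]
  · intro X Φ Ψ h
    obtain ⟨Θ, ⟨h₁, h₂⟩, hu⟩ := sq.existsUnique_cell Φ Ψ h
    have hk : rw (rw Θ d) c = Θ := by rw [rw_rw, hdc, rw_id]
    refine ⟨rw Θ d, ⟨by rw [← rw_rw, hk, h₁], by rw [← rw_rw, hk, h₂]⟩, ?_⟩
    rintro Θ' ⟨h₃, h₄⟩
    rw [← hu (rw Θ' c) ⟨by rw [rw_rw, h₃], by rw [rw_rw, h₄]⟩, rw_rw, hcd, rw_id]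

/-- Two pullbacks of the same cospan are isomorphic. -/
theorem exists_iso (sq : IsTwoPullback top left p f) {Q : K} {top' : Q ⟶ E} {left' : Q ⟶ A}
    (sq' : IsTwoPullback top' left' p f) : ∃ (c : Q ⟶ P) (d : P ⟶ Q), c ≫ d = 𝟙 Q ∧ d ≫ c = 𝟙 P ∧
      c ≫ top = top' ∧ c ≫ left = left' ∧ d ≫ top' = top ∧ d ≫ left' = left := by
  obtain ⟨c, ⟨h₁, h₂⟩, -⟩ := sq.existsUnique_lift top' left' sq'.w
  obtain ⟨d, ⟨h₃, h₄⟩, -⟩ := sq'.existsUnique_lift top left sq.w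
  refine ⟨c, d, sq'.hom_ext ?_ ?_, sq.hom_ext ?_ ?_, h₁, h₂, h₃, h₄⟩ <;>
    simp only [Strict.assoc, Strict.id_comp, h₁, h₂, h₃, h₄]

theorem id_left (p : E ⟶ B) : IsTwoPullback (𝟙 E) p p (𝟙 B) := by
  refine of_cells (by rw [Strict.id_comp, Strict.comp_id]) ?_ ?_
  · intro X e a h
    rw [Strict.comp_id] at h
    exact ⟨e, ⟨Strict.comp_id _, h⟩, fun k hk => by rw [← hk.1, Strict.comp_id]⟩
  · intro X Φ Ψ h
    rw [rw_id] at h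
    exact ⟨Φ, ⟨rw_id _, h⟩, fun k hk => by rw [← hk.1, rw_id]⟩

theorem id_top (f : A ⟶ B) : IsTwoPullback f (𝟙 A) (𝟙 B) f := by
  refine of_cells (by rw [Strict.id_comp, Strict.comp_id]) ?_ ?_
  · intro X e a h
    rw [Strict.comp_id] at h
    exact ⟨a, ⟨h.symm, Strict.comp_id _⟩, fun k hk => by rw [← hk.2, Strict.comp_id]⟩
  · intro X Φ Ψ h
    rw [rw_id] at h
    exact ⟨Ψ, ⟨h.symm, rw_id _⟩, fun k hk => by rw [← hk.2, rw_id]⟩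

/-- Discrete opfibrations are stable under pullback. -/
theorem isDiscOpfib (sq : IsTwoPullback top left p f) (hp : IsDiscOpfib p) : IsDiscOpfib left := by
  intro X e b φ
  -- The image of `φ` in the base of `p` is lifted to `E`; this lift and `φ` itself are the two
  -- components of the required 2-cell into `P`.
  obtain ⟨Λ, h₁, h₂⟩ := hp.exists_lift (e ≫ top) (rw (of φ) f)
    (by simp only [of, rw_src, Strict.assoc, sq.w])
  obtain ⟨Θ, ⟨h₃, h₄⟩, -⟩ := sq.existsUnique_cell Λ (of φ) h₂
  have hs : Θ.src = e := sq.hom_ext ((congrArg TwoCell.src h₃).trans h₁)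
    (congrArg TwoCell.src h₄)
  obtain ⟨θ, hθ⟩ := Θ.exists_hom hs rfl
  refine ⟨⟨Θ.tgt, θ⟩, of_eq_of.1 ?_, ?_⟩
  · rw [of_whiskerRight, hθ, h₄]
  · rintro ⟨t, ψ⟩ hψ
    have h₅ : rw (of ψ) left = of φ := of_eq_of.2 hψ
    have : of ψ = of θ := by
      refine sq.cell_ext (hp.eq_of_rw_eq ?_ ?_) ?_
      · rfl
      · rw [rw_rw, rw_rw, sq.w, ← rw_rw, ← rw_rw, h₅, hθ, h₄]
      · rw [h₅, hθ, h₄]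
    obtain ⟨-, rfl, h⟩ := of_eq_of.1 this
    rw [eq_of_heq h]

end IsTwoPullback

end Pullbacks

/-! ### 2-cells into a 2-classifier -/

section Classifier

variable {K : Type u} [Bicategory.{w, v} K]

open TwoCell

/-- Describes the map induced by `φ` without choices: it is `h` exactly when the lift of `left ◁ φ`
starting at `top` ends at `h ≫ top'`. Through this, full faithfulness becomes a statement about
pairs of 2-cells, one lying over the other. -/
theorem IsTwoPullback.coe_reindex_eq_iff [Bicategory.Strict K] {E A B P P' : K} {p : E ⟶ B}
    (hp : IsDiscOpfib p)
    {top : P ⟶ E} {left : P ⟶ A} {f f' : A ⟶ B} {top' : P' ⟶ E} {left' : P' ⟶ A}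
    (sq : IsTwoPullback top left p f) (sq' : IsTwoPullback top' left' p f') (φ : f ⟶ f')
    {h : P ⟶ P'} (hh : h ≫ left' = left) :
    reindex hp sq sq' φ = ⟨h, hh⟩ ↔
      ∃ Λ : TwoCell P E, Λ.src = top ∧ Λ.tgt = h ≫ top' ∧ rw Λ p = lw left (of φ) := by
  have e : of (eqToHom sq.w ≫ left ◁ φ) = lw left (of φ) :=
    (of_comp _ _).trans ((comp_congr (of_eqToHom sq.w) rfl).trans (one_comp _ _ _))
  rw [← e, ← hp.push_eq_iff, Subtype.ext_iff]
  constructor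
  · intro H
    exact (sq'.lift_top _ _ (hp.push_comp _ _)).symm.trans (congrArg (· ≫ top') H)
  · intro H
    exact sq'.hom_ext ((sq'.lift_top _ _ (hp.push_comp _ _)).trans H)
      ((sq'.lift_left _ _ (hp.push_comp _ _)).trans hh.symm)

variable [Enhancement K] {Ω' Ω : K} {u : Ω' ⟶ Ω} {S : SmallClass K}

namespace IsTwoClassifier

theorem discOpfib (hu : IsTwoClassifier S u) : IsDiscOpfib u :=
  (S.tightDiscOpfib hu.small).discOpfib

/-- Small discrete opfibrations detect tightness. -/
theorem detects_tight (hu : IsTwoClassifier S u) {E B X : K} {p : E ⟶ B} (hp : S.Small p)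
    {h : X ⟶ E} (hh : IsTight (h ≫ p)) : IsTight h := by
  obtain ⟨f, top, sq⟩ := hu.exists_classifies p hp
  exact sq.detects_tight h hh

variable [Bicategory.Strict K] {P B : K} {top : P ⟶ Ω'} {left : P ⟶ B} {f : B ⟶ Ω}

/-- A map between pullbacks of `u`, over the base, comes from a 2-cell of classifying maps. -/
theorem exists_cell (hK : IsPlumbus K) (hu : IsTwoClassifier S u)
    (sq : IsTwoPullback top left u f) {f' : B ⟶ Ω} (e' : P ⟶ Ω') (he' : e' ≫ u = left ≫ f') :
    ∃ (Φ : TwoCell B Ω) (Λ : TwoCell P Ω'), Φ.src = f ∧ Φ.tgt = f' ∧ Λ.src = top ∧ Λ.tgt = e' ∧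
      rw Λ u = lw left Φ := by
  -- Full faithfulness speaks of left-tight pullbacks only, whereas `sq` is an arbitrary one; the
  -- argument is transported along the isomorphism with a left-tight choice.
  obtain ⟨P₀, t₀, l₀, sq₀⟩ := hK.exists_pullback u f (S.tightDiscOpfib hu.small)
  obtain ⟨P₁, t₁, l₁, sq₁⟩ := hK.exists_pullback u f' (S.tightDiscOpfib hu.small)
  obtain ⟨c, d, hcd, -, h₁, h₂, -, h₄⟩ := sq₀.toIsTwoPullback.exists_iso sq
  obtain ⟨k, ⟨hk₁, hk₂⟩, -⟩ := sq₁.existsUnique_lift (d ≫ e') l₀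
    (by rw [Strict.assoc, he', ← Strict.assoc, h₄])
  obtain ⟨φ, hφ⟩ := (hu.fullyFaithful sq₀ sq₁).2 ⟨k, hk₂⟩
  obtain ⟨Λ, hs, ht, hΛ⟩ := (IsTwoPullback.coe_reindex_eq_iff _ _ _ _ _).1 hφ
  refine ⟨of φ, lw c Λ, rfl, rfl, ?_, ?_, ?_⟩
  · rw [lw_src, hs, h₁]
  · rw [lw_tgt, ht, hk₁, ← Strict.assoc, hcd, Strict.id_comp]
  · rw [lw_rw, hΛ, lw_lw, h₂]

/-- The 2-cell of classifying maps inducing a given map between pullbacks of `u` is unique. -/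
theorem cell_ext (hK : IsPlumbus K) (hu : IsTwoClassifier S u)
    (sq : IsTwoPullback top left u f) {Φ Ψ : TwoCell B Ω} {Λ M : TwoCell P Ω'}
    (hΦ : Φ.src = f) (hΨ : Ψ.src = f) (ht : Φ.tgt = Ψ.tgt) (hΛ : Λ.src = top) (hM : M.src = top)
    (ht' : Λ.tgt = M.tgt) (h₁ : rw Λ u = lw left Φ) (h₂ : rw M u = lw left Ψ) : Φ = Ψ := by
  obtain ⟨s, f', φ⟩ := Φ
  obtain ⟨s', f'', ψ⟩ := Ψ
  obtain rfl : s = f := hΦ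
  obtain rfl : s' = s := hΨ
  obtain rfl : f' = f'' := ht
  obtain ⟨P₀, t₀, l₀, sq₀⟩ := hK.exists_pullback u s' (S.tightDiscOpfib hu.small)
  obtain ⟨P₁, t₁, l₁, sq₁⟩ := hK.exists_pullback u f' (S.tightDiscOpfib hu.small)
  obtain ⟨c, d, -, -, -, -, h₃, h₄⟩ := sq₀.toIsTwoPullback.exists_iso sq
  obtain ⟨k, ⟨hk₁, hk₂⟩, -⟩ := sq₁.existsUnique_lift (d ≫ Λ.tgt) l₀ (by
    rw [Strict.assoc, show Λ.tgt ≫ u = left ≫ f' from congrArg TwoCell.tgt h₁, ← Strict.assoc, h₄])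
  -- Any 2-cell covered by some `N` from `top` to `Λ.tgt` induces the same map `k`; faithfulness
  -- then identifies `φ` and `ψ`.
  have key : ∀ (χ : s' ⟶ f') (N : TwoCell P Ω'), N.src = top → N.tgt = Λ.tgt →
      rw N u = lw left (of χ) →
        IsTwoPullback.reindex (S.tightDiscOpfib hu.small).discOpfib sq₀.toIsTwoPullback
          sq₁.toIsTwoPullback χ = ⟨k, hk₂⟩ := by
    intro χ N hs ht hN
    refine (IsTwoPullback.coe_reindex_eq_iff _ _ _ _ _).2 ⟨lw d N, ?_, ?_, ?_⟩
    · rw [lw_src, hs, h₃]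
    · rw [lw_tgt, ht, hk₁]
    · rw [lw_rw, hN, lw_lw, h₄]
  have := (hu.fullyFaithful sq₀ sq₁).1 ((key φ Λ hΛ rfl h₁).trans (key ψ M hM ht'.symm h₂).symm)
  rw [this]

/-- A classifying map of an identity has no nontrivial endomorphisms. -/
theorem cell_eq_one (hK : IsPlumbus K) (hu : IsTwoClassifier S u) {z : B ⟶ Ω} {t : B ⟶ Ω'}
    (sq : IsTwoPullback t (𝟙 B) u z) {Φ : TwoCell B Ω} (hs : Φ.src = z) (ht : Φ.tgt = z) :
    Φ = one z := by
  obtain ⟨Λ, h₁, h₂⟩ := hu.discOpfib.exists_lift t Φ (by rw [sq.w, hs, Strict.id_comp])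
  -- The pullback has identity left leg, so `t` is the only map to `Ω'` lying over `z`.
  have h₃ : Λ.tgt = t := by
    have e : Λ.tgt ≫ u = z := (congrArg TwoCell.tgt h₂).trans ht
    obtain ⟨k, ⟨hk₁, hk₂⟩, -⟩ := sq.existsUnique_lift Λ.tgt (𝟙 B) (by rw [e, Strict.id_comp])
    rw [Strict.comp_id] at hk₂
    rw [← hk₁, hk₂, Strict.id_comp]
  refine hu.cell_ext hK sq (M := one t) hs rfl ht h₁ rfl h₃ ?_ ?_
  · rw [h₂, id_lw]
  · rw [rw_one, lw_one, sq.w]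

/-- A pullback of `u` whose domain is generated by the domain of an identity classified by a
restriction of the same map has only one top side. -/
theorem top_eq (hK : IsPlumbus K) (hu : IsTwoClassifier S u) (sq : IsTwoPullback top left u f)
    {top' : P ⟶ Ω'} (h' : top' ≫ u = left ≫ f) {Z : K} {t : Z ⟶ Ω'} {z : Z ⟶ B} {r : P ⟶ Z}
    (sqZ : IsTwoPullback t (𝟙 Z) u (z ≫ f)) (Λ : TwoCell P P) (hs : Λ.src ≫ left = r ≫ z)
    (ht : Λ.tgt = 𝟙 P) : top' = top := by
  -- The second top side `top'` is encoded as an endomorphism `Φ` of `f`, covered by `N` from `top`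
  -- to `top'`. Its restriction along `z` is trivial.
  obtain ⟨Φ, N, h₁, h₂, h₃, h₄, h₅⟩ := hu.exists_cell hK sq top' h'
  have hz : lw z Φ = one (z ≫ f) :=
    hu.cell_eq_one hK sqZ (congrArg (z ≫ ·) h₁) (congrArg (z ≫ ·) h₂)
  -- Interchange of `Λ` with `Φ`: one side starts with `Φ` restricted along `r ≫ z`, an identity;
  -- the other ends with `Φ` along `left`, the image of `N`. Hence `Λ ▷ top` and its composite with
  -- `N` have the same image under `u`. By uniqueness of lifts they are equal, and so are their
  -- targets `top` and `top'`.
  have hx := exchange (rw Λ left) Φ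
  have e₁ : lw (rw Λ left).src Φ = one (r ≫ z ≫ f) := by
    rw [rw_src, hs, ← lw_lw, hz, lw_one]
  have e₂ : lw (rw Λ left).tgt Φ = rw N u := by
    rw [rw_tgt, ht, Strict.id_comp, h₅]
  have e₃ : ∀ g, g = f → rw (rw Λ left) g = rw (rw Λ top) u := by
    rintro g rfl
    rw [rw_rw, rw_rw, sq.w]
  have hN : (rw Λ top).tgt = N.src := by rw [rw_tgt, ht, h₃, Strict.id_comp]
  have hx' : rw (rw Λ top) u = rw ((rw Λ top).comp N hN) u :=
    (one_comp _ _ _).symm.trans ((comp_congr e₁ (e₃ _ h₂)).symm.trans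
      (hx.trans ((comp_congr (e₃ _ h₁) e₂).trans (rw_comp _ _ hN u).symm)))
  have := congrArg TwoCell.tgt (hu.discOpfib.eq_of_rw_eq (Λ := rw Λ top)
    (M := (rw Λ top).comp N hN) rfl hx')
  rw [rw_tgt, ht, Strict.id_comp, comp_tgt, h₄] at this
  exact this.symm

/-- The domain of `u` is generated by a map from the terminal object classifying the identity. -/
theorem exists_point (hK : IsPlumbus K) (hu : IsTwoClassifier S u) :
    ∃ (Z : K) (t' : Z ⟶ Ω') (t : Z ⟶ Ω) (r : Ω' ⟶ Z) (Λ : TwoCell Ω' Ω'),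
      IsTwoPullback t' (𝟙 Z) u t ∧ Λ.src = r ≫ t' ∧ Λ.tgt = 𝟙 Ω' := by
  obtain ⟨Z, hZ⟩ := hK.exists_terminal
  obtain ⟨t, t', sq⟩ := hu.exists_classifies _ (S.id_terminal hZ)
  obtain ⟨⟨⟨r⟩, -⟩⟩ := hZ.unique_hom Ω'
  -- The constant map `r ≫ t` classifies the identity of `Ω'`. The identity, viewed as a top side
  -- over `u`, is a section of the pullback of `u` along itself; the 2-cell covering it is the
  -- required `Λ`.
  obtain ⟨Φ, Λ, -, -, h₁, h₂, -⟩ := hu.exists_cell hK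
    ((IsTwoPullback.id_top r).paste sq.toIsTwoPullback) (𝟙 Ω') (f' := u) rfl
  exact ⟨Z, t', t, r, Λ, sq.toIsTwoPullback, h₁, h₂⟩

end IsTwoClassifier

end Classifier

/-! ### The algebra structure on the domain of `u` -/

namespace EnhancedMonad

namespace LiftingHypotheses

variable {K : Type u} [Bicategory.{w, v} K] [Bicategory.Strict K] [Enhancement K]
  {M : EnhancedMonad K} {S : SmallClass K} {Ω' Ω : K} {u : Ω' ⟶ Ω}
  {ω' : M.T.obj Ω' ⟶ Ω'} {ω : M.T.obj Ω ⟶ Ω}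

/-- `T` preserves all pullbacks of `u`, not only the left-tight ones. -/
theorem map_pullback (h : LiftingHypotheses S M u ω' ω) (hK : IsPlumbus K)
    (hu : IsTwoClassifier S u) {P B : K} {top : P ⟶ Ω'} {left : P ⟶ B} {f : B ⟶ Ω}
    (sq : IsTwoPullback top left u f) :
    IsTwoPullback (M.T.map top) (M.T.map left) (M.T.map u) (M.T.map f) := by
  obtain ⟨P₀, t₀, l₀, sq₀⟩ := hK.exists_pullback u f (S.tightDiscOpfib hu.small)
  obtain ⟨c, d, hcd, hdc, h₁, h₂, -, -⟩ := sq₀.toIsTwoPullback.exists_iso sq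
  rw [← h₁, ← h₂, M.T.map_comp, M.T.map_comp]
  refine (h.preserves_pullback sq₀).of_iso (d := M.T.map d) ?_ ?_
  · rw [← M.T.map_comp, hcd, M.T.map_id]
  · rw [← M.T.map_comp, hdc, M.T.map_id]

/-- If `f` classifies `p` then `T f ≫ ω` classifies `T p`. -/
theorem map_pullback_paste (h : LiftingHypotheses S M u ω' ω) (hK : IsPlumbus K)
    (hu : IsTwoClassifier S u) {P B : K} {top : P ⟶ Ω'} {left : P ⟶ B} {f : B ⟶ Ω}
    (sq : IsTwoPullback top left u f) :
    IsTwoPullback (M.T.map top ≫ ω') (M.T.map left) u (M.T.map f ≫ ω) :=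
  (h.map_pullback hK hu sq).paste h.classifies.toIsTwoPullback

/-- The top side of the square exhibiting `ω` as a classifying map of `T u` is a `T`-algebra. -/
theorem isAlgebra_top (h : LiftingHypotheses S M u ω' ω) (hK : IsPlumbus K)
    (hu : IsTwoClassifier S u) : M.IsAlgebra ω' := by
  have hw : ω' ≫ u = M.T.map u ≫ ω := h.classifies.w
  obtain ⟨Z, t', t, r, Λ, sqZ, hs, ht⟩ := hu.exists_point hK
  refine ⟨?_, ?_, ?_⟩
  · refine hu.detects_tight hu.small ?_
    rw [hw]
    exact comp_tight _ _ (M.map_tight _ (S.tightDiscOpfib hu.small).tight) h.tight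
  -- Both `𝟙 Ω'` and `M.unit Ω' ≫ ω'` are top sides over the identity of `Ω`.
  · refine hu.top_eq hK (IsTwoPullback.id_left u) ?_ (z := t) (r := r) (t := t') ?_ Λ ?_ ht
    · rw [Strict.assoc, hw, ← Strict.assoc, ← M.unit_natural, Strict.assoc, h.unit]
    · rw [Strict.comp_id]
      exact sqZ
    · rw [hs, Strict.assoc, sqZ.w, Strict.id_comp]
  -- Both composites are top sides over `T ω ≫ ω`. Since `T` preserves identities, the point `t`
  -- mapped by `T` twice still restricts this map to one classifying an identity, and `T (T Λ)`
  -- connects it to the identity of `T (T Ω')`.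
  · have sqT := h.map_pullback_paste hK hu (h.map_pullback_paste hK hu sqZ)
    have sq := h.map_pullback_paste hK hu h.classifies.toIsTwoPullback
    rw [M.T.map_id, M.T.map_id, M.T.map_comp (M.T.map t), Strict.assoc] at sqT
    refine (hu.top_eq hK sq ?_ (z := M.T.map (M.T.map t)) (r := M.T.map (M.T.map r)) sqT
      ((Λ.map M).map M) ?_ ?_).symm
    · rw [Strict.assoc, hw, ← Strict.assoc, ← M.mult_natural, Strict.assoc, h.mult]
    · rw [TwoCell.map_src, TwoCell.map_src, hs, ← M.T.map_comp, ← M.T.map_comp, ← M.T.map_comp,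
        ← M.T.map_comp, Strict.assoc, sqZ.w, Strict.id_comp]
    · rw [TwoCell.map_tgt, TwoCell.map_tgt, ht, M.T.map_id, M.T.map_id]

end LiftingHypotheses

end EnhancedMonad

/-! ### Laxators and pullbacks of algebras -/

namespace EnhancedMonad

variable {K : Type u} [Bicategory.{w, v} K] [Bicategory.Strict K] [Enhancement K]
  {M : EnhancedMonad K}

open TwoCell

namespace LaxHom

variable {A B C : M.Alg}

theorem exists_of_cell (f : A.carrier ⟶ B.carrier) (L : TwoCell (M.T.obj A.carrier) B.carrier)
    (hs : L.src = M.T.map f ≫ B.str) (ht : L.tgt = A.str ≫ f)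
    (hunit : lw (M.unit A.carrier) L = one f)
    (hc : (rw (map M L) B.str).tgt = (lw (M.T.map A.str) L).src)
    (hmult : lw (M.mult A.carrier) L =
      (rw (map M L) B.str).comp (lw (M.T.map A.str) L) hc) :
    ∃ F : LaxHom A B, F.hom = f ∧ of F.lax = L := by
  obtain ⟨φ, rfl⟩ := L.exists_hom hs ht
  exact ⟨⟨f, φ, of_eq_of.1 hunit, of_eq_of.1 hmult⟩, rfl, rfl⟩

theorem of_lax_unit (f : LaxHom A B) : lw (M.unit A.carrier) (of f.lax) = one f.hom :=
  of_eq_of.2 f.lax_unit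

theorem comp_aux₂ (f : LaxHom A B) : (rw (map M (of f.lax)) B.str).tgt =
    (lw (M.T.map A.str) (of f.lax)).src := by
  change M.T.map (A.str ≫ f.hom) ≫ B.str = M.T.map A.str ≫ M.T.map f.hom ≫ B.str
  rw [M.T.map_comp, Strict.assoc]

theorem of_lax_mult (f : LaxHom A B) : lw (M.mult A.carrier) (of f.lax) =
    (rw (map M (of f.lax)) B.str).comp (lw (M.T.map A.str) (of f.lax)) f.comp_aux₂ :=
  of_eq_of.2 f.lax_mult

theorem of_comp_lax (f : LaxHom A B) (g : LaxHom B C) : of (f.comp g).lax =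
    (lw (M.T.map f.hom) (of g.lax)).comp (rw (of f.lax) g.hom) (Strict.assoc _ _ _).symm :=
  of_eq_of.2 (comp_lax f g)

theorem IsStrict.of_lax {f : LaxHom A B} (hf : f.IsStrict) :
    of f.lax = one (M.T.map f.hom ≫ B.str) :=
  of_eq_of.2 hf

theorem of_comp_lax_of_isStrict_right (f : LaxHom A B) {g : LaxHom B C} (hg : g.IsStrict) :
    of (f.comp g).lax = rw (of f.lax) g.hom :=
  (of_comp_lax f g).trans ((comp_congr ((congrArg (lw _) hg.of_lax).trans (lw_one _ _)) rfl).trans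
    (one_comp _ _ _))

theorem of_comp_lax_of_isStrict_left {f : LaxHom A B} (hf : f.IsStrict) (g : LaxHom B C) :
    of (f.comp g).lax = lw (M.T.map f.hom) (of g.lax) :=
  (of_comp_lax f g).trans ((comp_congr rfl ((congrArg (fun X => rw X _) hf.of_lax).trans
    (rw_one _ _))).trans (comp_one _ _ _))

theorem ext_of {f g : LaxHom A B} (h : f.hom = g.hom) (hl : of f.lax = of g.lax) : f = g :=
  ext_cellEq h (of_eq_of.1 hl)

/-- Along a strict morphism which is a discrete opfibration, laxators are determined by their
images. -/
theorem ext_of_rw {f g : LaxHom A B} {p : LaxHom B C} (hp : IsDiscOpfib p.hom)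
    (hs : p.IsStrict) (h : f.hom = g.hom) (h' : f.comp p = g.comp p) : f = g := by
  refine ext_of h (hp.eq_of_rw_eq ?_ ?_)
  · change M.T.map f.hom ≫ B.str = M.T.map g.hom ≫ B.str
    rw [h]
  · rw [← of_comp_lax_of_isStrict_right f hs, ← of_comp_lax_of_isStrict_right g hs, h']

end LaxHom

namespace LaxCell

variable {A B : M.Alg}

theorem exists_of_cell {f g : LaxHom A B} (Θ : TwoCell A.carrier B.carrier) (hs : Θ.src = f.hom)
    (ht : Θ.tgt = g.hom) (h₁ : (of f.lax).tgt = (lw A.str Θ).src)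
    (h₂ : (rw (map M Θ) B.str).tgt = (of g.lax).src)
    (h : (of f.lax).comp (lw A.str Θ) h₁ = (rw (map M Θ) B.str).comp (of g.lax) h₂) :
    ∃ θ : f ⟶ g, of (LaxCell.cell θ) = Θ := by
  obtain ⟨θ, rfl⟩ := Θ.exists_hom hs ht
  exact ⟨⟨θ, of_injective ((of_comp _ _).trans (h.trans (of_comp _ _).symm))⟩, rfl⟩

theorem of_comm {f g : LaxHom A B} (σ : f ⟶ g) :
    (of f.lax).comp (lw A.str (of (LaxCell.cell σ))) rfl =
      (rw (map M (of (LaxCell.cell σ))) B.str).comp (of g.lax) rfl :=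
  (of_comp _ _).symm.trans ((congrArg of (LaxCell.comm σ)).trans (of_comp _ _))

theorem of_cell_congr {f g f' g' : A ⟶ B} {σ : f ⟶ g} {τ : f' ⟶ g'} (h : σ ≗ τ) :
    of (LaxCell.cell σ) = of (LaxCell.cell τ) := by
  obtain ⟨rfl, rfl, h⟩ := h
  rw [eq_of_heq h]

end LaxCell

section Pullback

variable {E B U' U : M.Alg} {t : E ⟶ U'} {p : E ⟶ B} {q : U' ⟶ U} {f : B ⟶ U}

/-- The factorization `k` in `K` acquires a laxator by lifting that of `a` along the discrete
opfibration `p`. Everything required of it is checked after composing with `p` or `q`, where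
uniqueness of lifts applies. -/
theorem exists_lift_of_underlying (hp : IsDiscOpfib p.hom) (hps : p.IsStrict)
    (hq : IsDiscOpfib q.hom) (hqs : q.IsStrict)
    (hw : t ≫ q = p ≫ f) (sq : IsTwoPullback t.hom p.hom q.hom f.hom) {X : M.Alg} (e : X ⟶ U')
    (a : X ⟶ B) (hea : e ≫ q = a ≫ f) : ∃ k : X ⟶ E, k ≫ t = e ∧ k ≫ p = a := by
  obtain ⟨k, ⟨hk₁, hk₂⟩, -⟩ := sq.existsUnique_lift e.hom a.hom
    (congrArg (LaxHom.hom (A := X) (B := U)) hea)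
  have hl : rw (of t.lax) q.hom = lw (M.T.map p.hom) (of f.lax) :=
    (LaxHom.of_comp_lax_of_isStrict_right t hqs).symm.trans
      ((congrArg (fun z : LaxHom E U => of z.lax) hw).trans
        (LaxHom.of_comp_lax_of_isStrict_left hps f))
  have hel : rw (of e.lax) q.hom = (lw (M.T.map a.hom) (of f.lax)).comp (rw (of a.lax) f.hom)
      (Strict.assoc _ _ _).symm :=
    (LaxHom.of_comp_lax_of_isStrict_right e hqs).symm.trans
      ((congrArg (fun z : LaxHom X U => of z.lax) hea).trans (LaxHom.of_comp_lax a f))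
  obtain ⟨Λ, hs, hΛ⟩ := hp.exists_lift (M.T.map k ≫ E.str) (of a.lax) (by
    rw [Strict.assoc, ← hps.comm, ← Strict.assoc, ← M.T.map_comp, hk₂]
    rfl)
  have hc : (lw (M.T.map k) (of t.lax)).tgt = (rw Λ t.hom).src := by
    rw [lw_tgt, rw_src, hs, Strict.assoc]
    rfl
  -- This is the laxator of the composite of `k` with `t`. It agrees with that of `e` because both
  -- lift, from the same source, the laxator of `e ≫ q = a ≫ f`.
  have hG : (lw (M.T.map k) (of t.lax)).comp (rw Λ t.hom) hc = of e.lax := by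
    refine hq.eq_of_rw_eq ?_ ?_
    · change M.T.map k ≫ M.T.map t.hom ≫ U'.str = M.T.map e.hom ≫ U'.str
      rw [← hk₁, M.T.map_comp, Strict.assoc]
    · rw [hel]
      refine (rw_comp _ _ _ _).trans (comp_congr ?_ ?_)
      · rw [lw_rw, hl, lw_lw, ← M.T.map_comp, hk₂]
      · rw [rw_rw, sq.w, ← rw_rw, hΛ]
  -- The lift `Λ` comes with no control over its target; the two projections of the pullback
  -- determine it, the first of them through `hG`.
  have ht : Λ.tgt = X.str ≫ k := by
    refine sq.hom_ext ?_ ?_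
    · rw [Strict.assoc, hk₁]
      exact congrArg TwoCell.tgt hG
    · rw [Strict.assoc, hk₂]
      exact congrArg TwoCell.tgt hΛ
  have hc' : (rw (map M Λ) E.str).tgt = (lw (M.T.map X.str) Λ).src := by
    rw [rw_tgt, map_tgt, lw_src, ht, hs, M.T.map_comp, Strict.assoc]
  have hunit : lw (M.unit X.carrier) Λ = one k := by
    refine hp.eq_of_rw_eq ?_ ?_
    · change M.unit X.carrier ≫ Λ.src = k
      rw [hs, ← Strict.assoc, ← M.unit_natural, Strict.assoc, E.isAlgebra.unit, Strict.comp_id]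
    · rw [lw_rw, hΛ, LaxHom.of_lax_unit, rw_one, hk₂]
  have hmult : lw (M.mult X.carrier) Λ =
      (rw (map M Λ) E.str).comp (lw (M.T.map X.str) Λ) hc' := by
    refine hp.eq_of_rw_eq ?_ ?_
    · change M.mult X.carrier ≫ Λ.src = M.T.map Λ.src ≫ E.str
      rw [hs, ← Strict.assoc, ← M.mult_natural, M.T.map_comp, Strict.assoc, Strict.assoc,
        E.isAlgebra.mult]
    · rw [lw_rw, hΛ, LaxHom.of_lax_mult]
      refine ((rw_comp _ _ _ _).trans (comp_congr ?_ ?_)).symm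
      · rw [rw_rw, ← hps.comm, ← rw_rw, ← map_rw, hΛ]
      · rw [lw_rw, hΛ]
  obtain ⟨F, rfl, hF⟩ := LaxHom.exists_of_cell k Λ hs ht hunit hc' hmult
  refine ⟨F, LaxHom.ext_of hk₁ ?_, LaxHom.ext_of hk₂ ?_⟩
  · refine (LaxHom.of_comp_lax F t).trans (Eq.trans (comp_congr rfl ?_) hG)
    rw [hF]
  · exact (LaxHom.of_comp_lax_of_isStrict_right F hps).trans (by rw [hF, hΛ])

/-- A square of algebras on strict discrete opfibrations which is a pullback on underlying objects
is a pullback of algebras and lax morphisms. -/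
theorem isTwoPullback_of_underlying (hp : IsDiscOpfib p.hom) (hps : p.IsStrict)
    (hq : IsDiscOpfib q.hom) (hqs : q.IsStrict)
    (hw : t ≫ q = p ≫ f) (sq : IsTwoPullback t.hom p.hom q.hom f.hom) :
    IsTwoPullback t p q f := by
  refine ⟨hw, fun X e a hea => ?_, fun X h k σ τ hστ => ?_⟩
  · obtain ⟨k, rfl, rfl⟩ := exists_lift_of_underlying hp hps hq hqs hw sq e a hea
    exact ⟨k, ⟨rfl, rfl⟩, fun k' ⟨h₁, h₂⟩ => LaxHom.ext_of_rw hp hps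
      (sq.hom_ext (congrArg (LaxHom.hom (A := X) (B := U')) h₁)
        (congrArg (LaxHom.hom (A := X) (B := B)) h₂)) h₂⟩
  · obtain ⟨θ, ⟨h₁, h₂⟩, hu⟩ := sq.existsUnique_lift₂ h.hom k.hom (LaxCell.cell σ)
      (LaxCell.cell τ) (of_eq_of.1 (LaxCell.of_cell_congr hστ))
    have h₂' : rw (of θ) p.hom = of (LaxCell.cell τ) := congrArg of h₂
    obtain ⟨θ', hθ⟩ := LaxCell.exists_of_cell (f := h) (g := k) (of θ) rfl rfl rfl rfl (by
      refine hp.eq_of_rw_eq rfl ?_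
      refine ((rw_comp _ _ _ _).trans (comp_congr ?_ ?_)).trans ((LaxCell.of_comm τ).trans
        (((rw_comp _ _ _ _).trans (comp_congr ?_ ?_)).symm))
      · exact (LaxHom.of_comp_lax_of_isStrict_right h hps).symm
      · rw [lw_rw, h₂']
      · rw [rw_rw, ← hps.comm, ← rw_rw, ← map_rw, h₂']
      · exact (LaxHom.of_comp_lax_of_isStrict_right k hps).symm)
    obtain rfl : LaxCell.cell θ' = θ := of_injective hθ
    exact ⟨θ', ⟨LaxCell.hom_ext h₁, LaxCell.hom_ext h₂⟩, fun θ'' ⟨h₃, h₄⟩ => LaxCell.hom_ext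
      (hu _ ⟨congrArg LaxCell.cell h₃, congrArg LaxCell.cell h₄⟩)⟩

/-- Tightness for algebras also demands strictness. If `h ≫ p` is strict, the laxator of `h` lifts
an identity along `p`, hence is itself an identity. -/
theorem isLeftTightPullback_of_underlying (hp : IsDiscOpfib p.hom) (hpt : IsTight p)
    (hd : ∀ ⦃X : K⦄ (h : X ⟶ E.carrier), IsTight (h ≫ p.hom) → IsTight h)
    (hq : IsDiscOpfib q.hom) (hqs : q.IsStrict)
    (hw : t ≫ q = p ≫ f) (sq : IsTwoPullback t.hom p.hom q.hom f.hom) :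
    IsLeftTightPullback t p q f where
  toIsTwoPullback := isTwoPullback_of_underlying hp hpt.1 hq hqs hw sq
  left_tight := hpt
  detects_tight X h hh := by
    refine ⟨of_eq_of.1 (hp.eq_of_rw_eq rfl ?_), hd _ hh.2⟩
    refine (LaxHom.of_comp_lax_of_isStrict_right h hpt.1).symm.trans
      ((LaxHom.IsStrict.of_lax hh.1).trans ?_)
    refine Eq.trans ?_ (rw_one _ _).symm
    change one (M.T.map (h.hom ≫ p.hom) ≫ B.str) = one ((M.T.map h.hom ≫ E.str) ≫ p.hom)
    rw [M.T.map_comp, Strict.assoc, Strict.assoc, hpt.1.comm]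

end Pullback

end EnhancedMonad

/-! ### Lax classifying maps -/

namespace EnhancedMonad

namespace LiftingHypotheses

variable {K : Type u} [Bicategory.{w, v} K] [Bicategory.Strict K] [Enhancement K]
  {M : EnhancedMonad K} {S : SmallClass K} {Ω' Ω : K} {u : Ω' ⟶ Ω}
  {ω' : M.T.obj Ω' ⟶ Ω'} {ω : M.T.obj Ω ⟶ Ω}

open TwoCell

/-- The data of a lax morphism into `(Ω, ω)`, in terms of `Ω` and `ω`. -/
theorem exists_eq_of_laxHom (h : LiftingHypotheses S M u ω' ω) {B : M.Alg}
    (f : LaxHom B h.algΩ) :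
    ∃ (g : B.carrier ⟶ Ω) (Φ : TwoCell (M.T.obj B.carrier) Ω)
      (hc : (rw (map M Φ) ω).tgt = (lw (M.T.map B.str) Φ).src), f.hom = g ∧ of f.lax = Φ ∧
      Φ.src = M.T.map g ≫ ω ∧ Φ.tgt = B.str ≫ g ∧ lw (M.unit B.carrier) Φ = one g ∧
      lw (M.mult B.carrier) Φ = (rw (map M Φ) ω).comp (lw (M.T.map B.str) Φ) hc :=
  ⟨f.hom, of f.lax, f.comp_aux₂, rfl, rfl, rfl, rfl, f.of_lax_unit, f.of_lax_mult⟩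

section Lift

variable {B : M.Alg} {P : K} {π : M.T.obj P ⟶ P} {p : P ⟶ B.carrier} {top : P ⟶ Ω'}
  {g : B.carrier ⟶ Ω} {Φ : TwoCell (M.T.obj B.carrier) Ω} {Λ : TwoCell (M.T.obj P) Ω'}

/-- `Λ` is the prospective laxator of `top`, lying over the laxator `Φ` of `g`. The axiom descends
from `Φ` by uniqueness of lifts along `u`. Nothing is asked of an algebra structure on `P`, so the
equation can also serve to construct one. -/
theorem lift_unit (hu : IsTwoClassifier S u) (h' : M.IsAlgebra ω')
    (hΦ : lw (M.unit B.carrier) Φ = one g) (hw : top ≫ u = p ≫ g)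
    (hs : Λ.src = M.T.map top ≫ ω') (hΛ : rw Λ u = lw (M.T.map p) Φ) :
    lw (M.unit P) Λ = one top := by
  refine hu.discOpfib.eq_of_rw_eq ?_ ?_
  · change M.unit P ≫ Λ.src = top
    rw [hs, ← Strict.assoc, ← M.unit_natural, Strict.assoc, h'.unit, Strict.comp_id]
  · rw [lw_rw, hΛ, lw_lw, ← M.unit_natural, ← lw_lw, hΦ, rw_one, hw, lw_one]

/-- Only compatibility of `π` with `B.str` and the matching of boundaries `hc` are needed, not the
algebra laws for `π`. Those laws are later read off from the targets. -/
theorem lift_mult (h : LiftingHypotheses S M u ω' ω) (hu : IsTwoClassifier S u)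
    (h' : M.IsAlgebra ω') {hcΦ : (rw (map M Φ) ω).tgt = (lw (M.T.map B.str) Φ).src}
    (hΦ : lw (M.mult B.carrier) Φ = (rw (map M Φ) ω).comp (lw (M.T.map B.str) Φ) hcΦ)
    (hπ : M.T.map p ≫ B.str = π ≫ p) (hs : Λ.src = M.T.map top ≫ ω')
    (hΛ : rw Λ u = lw (M.T.map p) Φ)
    (hc : (rw (map M Λ) ω').tgt = (lw (M.T.map π) Λ).src) :
    lw (M.mult P) Λ = (rw (map M Λ) ω').comp (lw (M.T.map π) Λ) hc := by
  refine hu.discOpfib.eq_of_rw_eq ?_ ?_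
  · change M.mult P ≫ Λ.src = M.T.map Λ.src ≫ ω'
    rw [hs, ← Strict.assoc, ← M.mult_natural, M.T.map_comp, Strict.assoc, Strict.assoc, h'.mult]
  · rw [lw_rw, hΛ, lw_lw, ← M.mult_natural, ← lw_lw, hΦ]
    refine (lw_comp _ _ _ _).trans (Eq.trans (comp_congr ?_ ?_) (rw_comp _ _ _ _).symm)
    · rw [rw_rw, h.classifies.w, ← rw_rw, ← map_rw, hΛ, map_lw, lw_rw]
    · rw [lw_rw, hΛ, lw_lw, lw_lw, ← M.T.map_comp, ← M.T.map_comp, hπ]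

end Lift

/-- A 2-cell over the laxator of `f` makes a pullback of `u` along `f.hom` a pullback of algebras. -/
theorem exists_isLeftTightPullback (h : LiftingHypotheses S M u ω' ω) (hu : IsTwoClassifier S u)
    (h' : M.IsAlgebra ω') {E B : M.Alg} (p : E ⟶ B) (hp : IsTight p) (hpS : S.Small p.hom)
    (f : B ⟶ h.algΩ) {top : E.carrier ⟶ Ω'} (sq : IsTwoPullback top p.hom u f.hom)
    {Λ : TwoCell (M.T.obj E.carrier) Ω'} (hs : Λ.src = M.T.map top ≫ ω')
    (ht : Λ.tgt = E.str ≫ top) (hΛ : rw Λ u = lw (M.T.map p.hom) (of f.lax)) :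
    ∃ t : E ⟶ (⟨Ω', ω', h'⟩ : M.Alg), t.hom = top ∧ IsLeftTightPullback t p (h.algU h') f := by
  have hc : (rw (map M Λ) ω').tgt = (lw (M.T.map E.str) Λ).src := by
    rw [rw_tgt, map_tgt, lw_src, ht, hs, M.T.map_comp, Strict.assoc]
  obtain ⟨g, Φ, hcΦ, hg, hΦ, -, -, hunit, hmult⟩ := h.exists_eq_of_laxHom f
  obtain ⟨t, rfl, htΛ⟩ := LaxHom.exists_of_cell (A := E) (B := ⟨Ω', ω', h'⟩) top Λ hs ht
    (lift_unit hu h' hunit (sq.w.trans (congrArg (p.hom ≫ ·) hg)) hs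
      (hΛ.trans (congrArg (lw _) hΦ))) hc
    (h.lift_mult hu h' hmult hp.1.comm hs (hΛ.trans (congrArg (lw _) hΦ)) hc)
  have hq : (h.algU h').IsStrict := CellEq.eqToHom_left h.classifies.w.symm
  refine ⟨t, rfl, isLeftTightPullback_of_underlying (S.tightDiscOpfib hpS).discOpfib hp
    (fun X k hk => hu.detects_tight hpS hk) hu.discOpfib hq ?_ sq⟩
  refine LaxHom.ext_of sq.w ?_
  refine (LaxHom.of_comp_lax_of_isStrict_right t hq).trans (Eq.trans ?_
    (LaxHom.of_comp_lax_of_isStrict_left hp.1 f).symm)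
  rw [htΛ]
  exact hΛ

/-- Every small discrete opfibration of algebras has a lax classifying map. -/
theorem exists_classifies (h : LiftingHypotheses S M u ω' ω) (hK : IsPlumbus K)
    (hu : IsTwoClassifier S u) (h' : M.IsAlgebra ω') {E B : M.Alg} (p : E ⟶ B) (hp : IsTight p)
    (hpS : S.Small p.hom) : ∃ f : B ⟶ h.algΩ, Classifies (h.algU h') p f := by
  obtain ⟨g, top, sq⟩ := hu.exists_classifies p.hom hpS
  have sqT := h.map_pullback_paste hK hu sq.toIsTwoPullback
  have sqTT := h.map_pullback_paste hK hu sqT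
  have hcomm : M.T.map p.hom ≫ B.str = E.str ≫ p.hom := hp.1.comm
  -- `E.str ≫ top` over `B.str ≫ g` encodes the cartesianity defect, so `Φ` is the laxator sought
  -- and `Λ` will be the laxator of `top`.
  obtain ⟨Φ, Λ, h₁, h₂, h₃, h₄, h₅⟩ := hu.exists_cell hK sqT (E.str ≫ top) (f' := B.str ≫ g)
    (by rw [Strict.assoc, sq.w, ← Strict.assoc, ← hcomm, Strict.assoc])
  -- Both sides are covered by 2-cells from `top` to `top`, the targets agreeing by the unit law of
  -- `E`; faithfulness gives equality.
  have hunit : lw (M.unit B.carrier) Φ = one g := by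
    refine hu.cell_ext hK sq.toIsTwoPullback (Λ := lw (M.unit E.carrier) Λ) (M := one top)
      ?_ rfl ?_ ?_ rfl ?_ ?_ ?_
    · rw [lw_src, h₁, ← Strict.assoc, ← M.unit_natural, Strict.assoc, h.unit, Strict.comp_id]
    · change M.unit _ ≫ Φ.tgt = g
      rw [h₂, ← Strict.assoc, B.isAlgebra.unit, Strict.id_comp]
    · rw [lw_src, h₃, ← Strict.assoc, ← M.unit_natural, Strict.assoc, h'.unit, Strict.comp_id]
    · change M.unit _ ≫ Λ.tgt = top
      rw [h₄, ← Strict.assoc, E.isAlgebra.unit, Strict.id_comp]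
    · rw [lw_rw, h₅, lw_lw, lw_lw, M.unit_natural]
    · rw [rw_one, lw_one, sq.w]
  have hc : (rw (map M Φ) ω).tgt = (lw (M.T.map B.str) Φ).src := by
    rw [rw_tgt, map_tgt, lw_src, h₁, h₂, M.T.map_comp, Strict.assoc]
  have hc' : (rw (map M Λ) ω').tgt = (lw (M.T.map E.str) Λ).src := by
    rw [rw_tgt, map_tgt, lw_src, h₃, h₄, M.T.map_comp, Strict.assoc]
  have hmult : lw (M.mult B.carrier) Φ =
      (rw (map M Φ) ω).comp (lw (M.T.map B.str) Φ) hc := by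
    -- The same argument over `T (T B)`: the targets of the two covering 2-cells agree by
    -- associativity of `E.str`, their sources by that of `ω'`.
    refine hu.cell_ext hK sqTT (Λ := lw (M.mult E.carrier) Λ)
      (M := (rw (map M Λ) ω').comp (lw (M.T.map E.str) Λ) hc') ?_ ?_ ?_ ?_ ?_ ?_ ?_ ?_
    · rw [lw_src, h₁, ← Strict.assoc, ← M.mult_natural, M.T.map_comp, Strict.assoc, Strict.assoc,
        h.mult]
    · rw [comp_src, rw_src, map_src, h₁]
    · rw [lw_tgt, comp_tgt, lw_tgt, h₂, ← Strict.assoc, ← Strict.assoc, B.isAlgebra.mult]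
    · rw [lw_src, h₃, ← Strict.assoc, ← M.mult_natural, M.T.map_comp, Strict.assoc, Strict.assoc,
        h'.mult]
    · rw [comp_src, rw_src, map_src, h₃]
    · rw [lw_tgt, comp_tgt, lw_tgt, h₄, ← Strict.assoc, ← Strict.assoc, E.isAlgebra.mult]
    · rw [lw_rw, h₅, lw_lw, lw_lw, M.mult_natural]
    · refine (rw_comp _ _ _ _).trans (Eq.trans (comp_congr ?_ ?_) (lw_comp _ _ _ _).symm)
      · rw [rw_rw, h.classifies.w, ← rw_rw, ← map_rw, h₅, map_lw, lw_rw]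
      · rw [lw_rw, h₅, lw_lw, lw_lw, ← M.T.map_comp, ← M.T.map_comp, hcomm]
  obtain ⟨f, rfl, hf⟩ := LaxHom.exists_of_cell (A := B) (B := h.algΩ) g Φ h₁ h₂ hunit hc hmult
  obtain ⟨t, -, hsq⟩ := h.exists_isLeftTightPullback hu h' p hp hpS f sq.toIsTwoPullback h₃ h₄
    (h₅.trans (congrArg (lw _) hf.symm))
  exact ⟨f, t, hsq⟩

/-- The pullback of `u` along the underlying map of a lax morphism into `Ω` lifts to algebras. -/
theorem exists_algebra_pullback (h : LiftingHypotheses S M u ω' ω) (hK : IsPlumbus K)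
    (hu : IsTwoClassifier S u) (h' : M.IsAlgebra ω') {B : M.Alg} (f : B ⟶ h.algΩ) :
    ∃ (E : M.Alg) (t : E ⟶ (⟨Ω', ω', h'⟩ : M.Alg)) (p : E ⟶ B),
      IsTwoPullback t.hom p.hom u f.hom ∧ IsTwoPullback t p (h.algU h') f := by
  obtain ⟨g, Φ, hcΦ, hg, hΦ, hΦs, hΦt, hunit, hmult⟩ := h.exists_eq_of_laxHom f
  obtain ⟨P, top, p, sq⟩ := hK.exists_pullback u g (S.tightDiscOpfib hu.small)
  -- Elements of `T P` are first sent to `Ω'` by `T top ≫ ω'` and then transported along the laxator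
  -- of `f`. The result lies over `B.str ≫ g`, so it defines the structure map `π`.
  obtain ⟨Λ, hs, hΛ⟩ := hu.discOpfib.exists_lift (M.T.map top ≫ ω') (lw (M.T.map p) Φ) (by
    rw [lw_src, hΦs, Strict.assoc, h.classifies.w, ← Strict.assoc, ← M.T.map_comp, sq.w,
      M.T.map_comp, Strict.assoc])
  have ht : Λ.tgt ≫ u = (M.T.map p ≫ B.str) ≫ g :=
    (congrArg TwoCell.tgt hΛ).trans (by rw [lw_tgt, hΦt, Strict.assoc])
  obtain ⟨π, ⟨hπ₁, hπ₂⟩, -⟩ := sq.existsUnique_lift Λ.tgt (M.T.map p ≫ B.str) ht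
  have hc : (rw (map M Λ) ω').tgt = (lw (M.T.map π) Λ).src := by
    rw [rw_tgt, map_tgt, lw_src, hs, ← hπ₁, M.T.map_comp, Strict.assoc]
  -- Equal 2-cells have equal targets: from the two laxator axioms for `Λ` this yields the algebra
  -- laws for `π` after composing with `top`.
  have hunit' := congrArg TwoCell.tgt (lift_unit hu h' hunit sq.w hs hΛ)
  have hmult' := congrArg TwoCell.tgt (h.lift_mult hu h' hmult hπ₂.symm hs hΛ hc)
  have hA : M.IsAlgebra π := by
    refine ⟨sq.detects_tight _ ?_, sq.hom_ext ?_ ?_, sq.hom_ext ?_ ?_⟩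
    · rw [hπ₂]
      exact comp_tight _ _ (M.map_tight _ sq.left_tight) B.isAlgebra.tight
    · rw [Strict.assoc, hπ₁, Strict.id_comp]
      exact hunit'
    · rw [Strict.assoc, hπ₂, ← Strict.assoc, ← M.unit_natural, Strict.assoc, B.isAlgebra.unit,
        Strict.id_comp, Strict.comp_id]
    · rw [Strict.assoc, Strict.assoc, hπ₁]
      exact hmult'.symm
    · rw [Strict.assoc, Strict.assoc, hπ₂, ← Strict.assoc, ← M.T.map_comp, hπ₂, M.T.map_comp,
        Strict.assoc, B.isAlgebra.mult, ← Strict.assoc, ← Strict.assoc, M.mult_natural]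
  let E : M.Alg := ⟨P, π, hA⟩
  let p' : E ⟶ B := LaxHom.ofStrict (A := E) p hπ₂.symm
  have hp' : IsTight p' := ⟨CellEq.eqToHom_left hπ₂.symm, sq.left_tight⟩
  obtain ⟨t, rfl, hsq⟩ := h.exists_isLeftTightPullback hu h' p' hp'
    (S.pullback_stable hu.small sq) f (hg ▸ sq.toIsTwoPullback) hs hπ₁.symm
    (hΛ.trans (congrArg (lw _) hΦ.symm))
  exact ⟨E, t, p', hg ▸ sq.toIsTwoPullback, hsq.toIsTwoPullback⟩

/-- The forgetful 2-functor preserves pullbacks of `u` along lax morphisms. -/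
theorem isTwoPullback_underlying (h : LiftingHypotheses S M u ω' ω) (hK : IsPlumbus K)
    (hu : IsTwoClassifier S u) (h' : M.IsAlgebra ω') {E B : M.Alg} {p : E ⟶ B} {f : B ⟶ h.algΩ}
    {t : E ⟶ (⟨Ω', ω', h'⟩ : M.Alg)} (sq : IsTwoPullback t p (h.algU h') f) :
    IsTwoPullback t.hom p.hom u f.hom := by
  obtain ⟨E₀, t₀, p₀, sq₀, sqA⟩ := h.exists_algebra_pullback hK hu h' f
  obtain ⟨c, d, hcd, hdc, rfl, rfl, -, -⟩ := sqA.exists_iso sq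
  exact sq₀.of_iso (congrArg (LaxHom.hom (A := E) (B := E)) hcd)
    (congrArg (LaxHom.hom (A := E₀) (B := E₀)) hdc)

end LiftingHypotheses

end EnhancedMonad

/-! ### Invertible 2-cells and split equivalences -/

section SplitEquivalence

variable {K : Type u} [Bicategory.{w, v} K] [Bicategory.Strict K]

open TwoCell

theorem TwoCell.of_comp_of_eq_one {a b : K} {f g : a ⟶ b} {φ : f ⟶ g} {ψ : g ⟶ f}
    (h : φ ≫ ψ = 𝟙 f) : (of φ).comp (of ψ) rfl = one f :=
  (of_comp φ ψ).symm.trans (congrArg of h)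

/-- A split equivalence over a base into which its domain maps by a discrete opfibration is
an isomorphism. -/
theorem IsDiscOpfib.isSplitEquivalence_iff {P P' B : K} {l : P ⟶ B} {l' : P' ⟶ B}
    (hl : IsDiscOpfib l) {δ : P ⟶ P'} (hδ : δ ≫ l' = l) :
    IsSplitEquivalence δ ↔ ∃ s : P' ⟶ P, s ≫ δ = 𝟙 P' ∧ δ ≫ s = 𝟙 P := by
  constructor
  · rintro ⟨s, hs, ⟨θ⟩⟩
    refine ⟨s, hs, ?_⟩
    have hc : (rw (of θ.inv) (δ ≫ s)).tgt = (of θ.hom).src := by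
      change (δ ≫ s) ≫ δ ≫ s = δ ≫ s
      rw [Strict.assoc, ← Strict.assoc s, hs, Strict.id_comp]
    -- The isomorphism `θ` need not lie over the base. Preceding it by `θ.inv` whiskered with `δ ≫
    -- s` corrects this: the composite, from `δ ≫ s` to `𝟙 P`, becomes an identity after `δ`, hence
    -- over `B`. A lift of an identity is an identity, so its endpoints coincide.
    have hX : rw ((rw (of θ.inv) (δ ≫ s)).comp (of θ.hom) hc) δ = one δ := by
      refine (rw_comp _ _ _ _).trans (Eq.trans (comp_congr ?_ rfl) ((rw_comp _ _ _ δ).symm.trans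
        ((congrArg (fun X => rw X δ) (of_comp_of_eq_one θ.inv_hom_id)).trans ?_)))
      · rw [rw_rw, Strict.assoc, hs, Strict.comp_id]
      · rw [rw_one, Strict.id_comp]
    refine (congrArg TwoCell.tgt (hl.eq_of_rw_eq
      (Λ := (rw (of θ.inv) (δ ≫ s)).comp (of θ.hom) hc) (M := one (δ ≫ s)) ?_ ?_)).symm
    · exact Strict.id_comp _
    · rw [← hδ, ← rw_rw, hX, rw_one, rw_one, Strict.assoc, ← Strict.assoc s, hs, Strict.id_comp]
  · rintro ⟨s, h₁, h₂⟩
    exact ⟨s, h₁, ⟨eqToIso h₂⟩⟩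

variable [Enhancement K] {Ω' Ω : K} {u : Ω' ⟶ Ω} {S : SmallClass K}

/-- A 2-cell of classifying maps is invertible if and only if the map which it induces between
pullbacks of `u` is. -/
theorem IsTwoClassifier.isIso_iff (hK : IsPlumbus K) (hu : IsTwoClassifier S u) {P P' B : K}
    {t : P ⟶ Ω'} {l : P ⟶ B} {f : B ⟶ Ω} {t' : P' ⟶ Ω'} {l' : P' ⟶ B} {f' : B ⟶ Ω}
    (sq : IsTwoPullback t l u f) (sq' : IsTwoPullback t' l' u f') (φ : f ⟶ f') {δ : P ⟶ P'}
    (hδ : δ ≫ l' = l) {Λ : TwoCell P Ω'} (hs : Λ.src = t) (ht : Λ.tgt = δ ≫ t')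
    (hΛ : rw Λ u = lw l (of φ)) : IsIso φ ↔ ∃ s : P' ⟶ P, s ≫ δ = 𝟙 P' ∧ δ ≫ s = 𝟙 P := by
  constructor
  · intro hφ
    -- Lifting `inv φ` starting at `t'` produces the inverse map `s`. The composites of `Λ` and `M`
    -- lift identities, so their targets give the two equations on top sides.
    obtain ⟨M, hMs, hM⟩ := hu.discOpfib.exists_lift t' (lw l' (of (inv φ))) sq'.w
    obtain ⟨s, ⟨hs₁, hs₂⟩, -⟩ := sq.existsUnique_lift M.tgt l' (congrArg TwoCell.tgt hM)
    have hc₁ : M.tgt = (lw s Λ).src := by rw [lw_src, hs, hs₁]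
    have hc₂ : Λ.tgt = (lw δ M).src := by rw [lw_src, hMs, ht]
    refine ⟨s, sq'.hom_ext ?_ ?_, sq.hom_ext ?_ ?_⟩
    · have : M.comp (lw s Λ) hc₁ = one t' := by
        refine hu.discOpfib.eq_of_rw_eq hMs ?_
        refine (rw_comp _ _ _ _).trans (Eq.trans (comp_congr hM ?_) ((lw_comp l' _ _ rfl).symm.trans
          ((congrArg (lw l') (of_comp_of_eq_one (IsIso.inv_hom_id φ))).trans ?_)))
        · rw [lw_rw, hΛ, lw_lw, hs₂]
        · rw [lw_one, rw_one, sq'.w]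
      have := congrArg TwoCell.tgt this
      rw [comp_tgt, lw_tgt, ht] at this
      rw [Strict.assoc, Strict.id_comp]
      exact this
    · rw [Strict.assoc, Strict.id_comp, hδ, hs₂]
    · have : Λ.comp (lw δ M) hc₂ = one t := by
        refine hu.discOpfib.eq_of_rw_eq hs ?_
        refine (rw_comp _ _ _ _).trans (Eq.trans (comp_congr hΛ ?_) ((lw_comp l _ _ rfl).symm.trans
          ((congrArg (lw l) (of_comp_of_eq_one (IsIso.hom_inv_id φ))).trans ?_)))
        · rw [lw_rw, hM, lw_lw, hδ]
        · rw [lw_one, rw_one, sq.w]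
      have := congrArg TwoCell.tgt this
      rw [comp_tgt, lw_tgt, ← hs₁] at this
      rw [Strict.assoc, Strict.id_comp]
      exact this
    · rw [Strict.assoc, Strict.id_comp, hs₂, hδ]
  · rintro ⟨s, hsδ, hδs⟩
    have hsl : s ≫ l = l' := by rw [← hδ, ← Strict.assoc, hsδ, Strict.id_comp]
    -- Fullness turns `s` into a 2-cell backwards; faithfulness shows that it is inverse to `φ`,
    -- since the composites cover identities.
    obtain ⟨Ψ, M, h₁, h₂, h₃, h₄, h₅⟩ := hu.exists_cell hK sq' (s ≫ t) (f' := f)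
      (by rw [Strict.assoc, sq.w, ← Strict.assoc, hsl])
    obtain ⟨ψ, rfl⟩ := Ψ.exists_hom h₁ h₂
    have hc₁ : M.tgt = (lw s Λ).src := by rw [lw_src, hs, h₄]
    have hc₂ : Λ.tgt = (lw δ M).src := by rw [lw_src, h₃, ht]
    refine ⟨ψ, of_injective ?_, of_injective ?_⟩
    · refine (of_comp _ _).trans (hu.cell_ext hK sq (Ψ := one f) (Λ := Λ.comp (lw δ M) hc₂)
        (M := one t) rfl rfl rfl hs rfl ?_ ?_ ?_)
      · change δ ≫ M.tgt = t
        rw [h₄, ← Strict.assoc, hδs, Strict.id_comp]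
      · refine (rw_comp _ _ _ _).trans (Eq.trans (comp_congr hΛ ?_) (lw_comp l _ _ rfl).symm)
        rw [lw_rw, h₅, lw_lw, hδ]
      · rw [rw_one, lw_one, sq.w]
    · refine (of_comp _ _).trans (hu.cell_ext hK sq' (Ψ := one f') (Λ := M.comp (lw s Λ) hc₁)
        (M := one t') rfl rfl rfl h₃ rfl ?_ ?_ ?_)
      · change s ≫ Λ.tgt = t'
        rw [ht, ← Strict.assoc, hsδ, Strict.id_comp]
      · refine (rw_comp _ _ _ _).trans (Eq.trans (comp_congr h₅ ?_) (lw_comp l' _ _ rfl).symm)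
        rw [lw_rw, hΛ, lw_lw, hsl]
      · rw [rw_one, lw_one, sq'.w]

end SplitEquivalence

/-! ### Pseudo morphisms and cartesianity -/

namespace EnhancedMonad

namespace LiftingHypotheses

variable {K : Type u} [Bicategory.{w, v} K] [Bicategory.Strict K] [Enhancement K]
  {M : EnhancedMonad K} {S : SmallClass K} {Ω' Ω : K} {u : Ω' ⟶ Ω}
  {ω' : M.T.obj Ω' ⟶ Ω'} {ω : M.T.obj Ω ⟶ Ω}

open TwoCell

/-- A lax classifying map of `p` is a pseudo morphism if and only if the cartesianity defect of `p`
is a split equivalence. -/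
theorem isPseudo_iff_isSplitEquivalence (h : LiftingHypotheses S M u ω' ω) (hK : IsPlumbus K)
    (hu : IsTwoClassifier S u) (h' : M.IsAlgebra ω') {E B : M.Alg} {p : E ⟶ B} (hp : p.IsStrict)
    {f : B ⟶ h.algΩ} (hf : Classifies (h.algU h') p f) {P : K} {top : P ⟶ E.carrier}
    {left : P ⟶ M.T.obj B.carrier} (sq : IsTwoPullback top left p.hom B.str) :
    f.IsPseudo ↔ IsSplitEquivalence (cartesianityDefect p hp sq) := by
  obtain ⟨t, sqA⟩ := hf
  have sqK := h.isTwoPullback_underlying hK hu h' sqA.toIsTwoPullback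
  have sqT := h.map_pullback_paste hK hu sqK
  have hq : (h.algU h').IsStrict := CellEq.eqToHom_left h.classifies.w.symm
  have hl : rw (of t.lax) u = lw (M.T.map p.hom) (of f.lax) :=
    (LaxHom.of_comp_lax_of_isStrict_right t hq).symm.trans
      ((congrArg (fun z : LaxHom E h.algΩ => of z.lax) sqA.w).trans
        (LaxHom.of_comp_lax_of_isStrict_left hp f))
  have h₁ : cartesianityDefect p hp sq ≫ top = E.str := sq.lift_top _ _ _
  have h₂ : cartesianityDefect p hp sq ≫ left = M.T.map p.hom := sq.lift_left _ _ _
  rw [(sqT.isDiscOpfib hu.discOpfib).isSplitEquivalence_iff h₂]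
  -- The laxator of `t` lies over that of `f` and ends at `E.str ≫ t.hom`, which is the defect
  -- followed by the top side of the pasted square. So the map of pullbacks induced by `f.lax` is
  -- the defect.
  refine hu.isIso_iff hK sqT (sq.paste sqK) f.lax h₂ (Λ := of t.lax) rfl ?_ hl
  rw [← Strict.assoc, h₁]
  rfl

end LiftingHypotheses

end EnhancedMonad

theorem mainTheorem2 {K : Type u} [Bicategory.{w, v} K] [Bicategory.Strict K] [Enhancement K]
    (hK : IsPlumbus K) (S : SmallClass K) {Ω' Ω : K} (u : Ω' ⟶ Ω) (hu : IsTwoClassifier S u)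
    (M : EnhancedMonad K) (ω' : M.T.obj Ω' ⟶ Ω') (ω : M.T.obj Ω ⟶ Ω)
    (h : EnhancedMonad.LiftingHypotheses S M u ω' ω) :
    ∃ h' : M.IsAlgebra ω', ∀ (E B : M.Alg) (p : E ⟶ B) (hp : IsTightDiscOpfib p),
      S.Small p.hom →
        (∃ dp : B ⟶ h.algΩ, Classifies (h.algU h') p dp) ∧
        ∀ dp : B ⟶ h.algΩ, Classifies (h.algU h') p dp →
          (dp.IsPseudo ↔ EnhancedMonad.IsTCartesian p (EnhancedMonad.isStrict_of_isTight hp.tight)) := by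
  refine ⟨h.isAlgebra_top hK hu, fun E B p hp hpS =>
    ⟨h.exists_classifies hK hu _ p hp.tight hpS, fun dp hdp => ?_⟩⟩
  constructor
  · intro hps
    obtain ⟨P, top, left, sq⟩ := hK.exists_pullback p.hom B.str (S.tightDiscOpfib hpS)
    exact ⟨P, top, left, sq.toIsTwoPullback,
      (h.isPseudo_iff_isSplitEquivalence hK hu _ _ hdp sq.toIsTwoPullback).1 hps⟩
  · rintro ⟨P, top, left, sq, hs⟩
    exact (h.isPseudo_iff_isSplitEquivalence hK hu _ _ hdp sq).2 hs
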